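/- **Setting.** Write $[b]_+=\max(b,0)$. Let $(\mathbb P,\cdot,\oplus)$ be a semifield: a multiplicative abelian group with an associative, commutative addition $\oplus$ over which multiplication distributes. Let $\mathbb{QP}$ be the fraction field of the group ring $\mathbb{ZP}$, and $\mathcal F\supseteq\mathbb{QP}$ a field. A generalized seed $(\mathbf x,\mathbf y,B,\mathbf Z)$ over $\mathbb P$ consists of elements $x_1,\dots,x_n\in\mathcal F$ algebraically independent over $\mathbb{QP}$, elements $y_1,\dots,y_n\in\mathbb P$, a skew-symmetrizable integer $n\times n$ matrix $B=(b_{ij})$, and exchange polynomials $Z_i(u)=\sum_{s=0}^{d_i}z_{i,s}u^s$ with $d_i\ge 1$, $z_{i,s}\in\mathbb P$, $z_{i,0}=z_{i,d_i}=1$. Put $\hat y_k=y_k\prod_i x_i^{b_{ik}}$, and let $Z_k|_{\mathbb P}(y_k)=\bigoplus_s z_{k,s}y_k^s$. Mutation in direction $k$ gives $(\mathbf x',\mathbf y',B',\mathbf Z')$, where $x_i'=x_i$ for $i\neq k$ and $$x_k'x_k=\Big(\prod_i x_i^{[-b_{ik}]_+}\Big)^{d_k}\frac{Z_k(\hat y_k)}{Z_k|_{\mathbb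 P}(y_k)};$$ $y_k'=y_k^{-1}$ and $y_j'=y_j\,(y_k^{d_k})^{[b_{kj}]_+}\,Z_k|_{\mathbb P}(y_k)^{-b_{kj}}$ for $j\ne k$; $b_{ij}'=-b_{ij}$ if $i=k$ or $j=k$, and $b'_{ij}=b_{ij}+[b_{ik}]_+d_kb_{kj}+b_{ik}d_k[-b_{kj}]_+$ otherwise; $Z_i'=Z_i$ for $i\ne k$ and $Z_k'(u)=u^{d_k}Z_k(u^{-1})$. Ordinary seeds $(\mathbf x,\mathbf y,B)$ and their mutations are the case where every $d_i=1$ and $Z_i(u)=1+u$. Given an initial (generalized) seed at a vertex $t_0$ of the $n$-regular tree $\mathbb T_n$ with edges labelled by $1,\dots,n$, the seed at a vertex $t$ is obtained by mutating successively in the directions that label a path from $t_0$ to $t$; its components carry the superscript $t$. **$c$-vectors, $g$-vectors, $F$-polynomials.** Let $\mathbf x,\mathbf y$ and $\mathbf z=(z_{i,s})_{1\le i\le n,\,0<s<d_i}$ be formal variables, and put $z_{i,0}=z_{i,d_i}=1$. Let $\mathbb Q_{\rm sf}(\cdot)$ denote the universal semifield of subtraction-free rational functions, and $\mathrm{Trop}(\cdot)$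 the tropical semifield of Laurent monomials, with $\oplus$ taking the minimum of the exponents. Let $X_j^t\in\mathbb Q_{\rm sf}(\mathbf x,\mathbf y,\mathbf z)$ be the $j$-th cluster variable at $t$ for the initial generalized seed $(\mathbf x,\mathbf y,B,\mathbf Z)$ over $\mathrm{Trop}(\mathbf y,\mathbf z)$, and $Y_j^t\in\mathbb Q_{\rm sf}(\mathbf y,\mathbf z)$ the $j$-th coefficient at $t$ for the initial data $\mathbf y,B,\mathbf Z$ over $\mathbb Q_{\rm sf}(\mathbf y,\mathbf z)$. Let $c^t_{ij}$ be the exponent of $y_i$ in the monomial $Y^t_j|_{\mathrm{Trop}(\mathbf y,\mathbf z)}$. Let $(g^t_{1j},\dots,g^t_{nj})\in\mathbb Z^n$ be the degree of $X_j^t$, which is homogeneous for the grading $\deg x_i=\mathbf e_i$, $\deg y_j=-(\text{the }j\text{-th column of }B)$, $\deg z_{i,s}=0$. Let $F^t_j(\mathbf y,\mathbf z)=X^t_j(\mathbf 1,\mathbf y,\mathbf z)$. These depend only on $B$, $(d_i)$ and $t$. **Binomial specialization.** Let $z^{\rm bin}_{i,s}=\binom{d_i}{s}$. For an initial generalized seed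 $(\mathbf x,\mathbf y,B,\mathbf Z)$ over $\mathbb P$ with exchange polynomials of degrees $d_i$, consider $F^t_j(\mathbf y,\mathbf z^{\rm bin})\in\mathbb Q_{\rm sf}(\mathbf y)$. Write $F^t_j|_{\mathbb P}$ for its evaluation in the semifield $\mathbb P$ and $F^t_j|_{\mathcal F}$ for its evaluation in the field $\mathcal F$, and set $$y_j^t\big|_{\mathbf z=\mathbf z^{\rm bin}}=\prod_i y_i^{c^t_{ij}}\prod_i F^t_i|_{\mathbb P}(\mathbf y,\mathbf z^{\rm bin})^{b^t_{ij}}\in\mathbb P,\qquad x_j^t\big|_{\mathbf z=\mathbf z^{\rm bin}}=\Big(\prod_i x_i^{g^t_{ij}}\Big)\frac{F^t_j|_{\mathcal F}(\hat{\mathbf y},\mathbf z^{\rm bin})}{F^t_j|_{\mathbb P}(\mathbf y,\mathbf z^{\rm bin})}\in\mathcal F .$$ **Left companion.** Let $D=\mathrm{diag}(d_1,\dots,d_n)$, and let $\mathbf x^{1/\mathbf d}=(x_1^{1/d_1},\dots,x_n^{1/d_n})$ be a choice of roots in an extension field of $\mathcal F$. Let $({}^L\mathbf x^t,{}^L\mathbf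 y^t)$ be the cluster and the coefficients at $t$ in the ordinary cluster pattern with initial seed $(\mathbf x^{1/\mathbf d},\mathbf y,DB)$ at $t_0$. **Theorem.** For every vertex $t\in\mathbb T_n$ and all $1\le i,j\le n$, $$x_i^t\big|_{\mathbf z=\mathbf z^{\rm bin}}=\big({}^Lx_i^t\big)^{d_i}\qquad\text{and}\qquad y_j^t\big|_{\mathbf z=\mathbf z^{\rm bin}}={}^Ly_j^t .$$ -/

import Mathlib

open scoped BigOperators

noncomputable section

namespace GenCluster

/-! ## Semifields -/

/-- A semifield in the sense of cluster algebra theory: a multiplicative abelian group with an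
auxiliary addition `⊕` (written `+`) that is associative, commutative and distributive.
There is no zero element. -/
class ClusterSemifield (P : Type*) extends CommGroup P, AddCommSemigroup P, Distrib P

/-- `f 0 ⊕ f 1 ⊕ ⋯ ⊕ f d`, a sum of `d + 1 ≥ 1` terms, which makes sense without a zero. -/
def oplusSum {A : Type*} [Add A] : (d : ℕ) → (Fin (d + 1) → A) → A
  | 0, f => f 0
  | d + 1, f => oplusSum d (fun s => f s.castSucc) + f (Fin.last (d + 1))

theorem mul_oplusSum {P : Type*} [ClusterSemifield P] (a : P) :
    ∀ (d : ℕ) (f : Fin (d + 1) → P), a * oplusSum d f = oplusSum d (fun s => a * f s)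
  | 0, _ => rfl
  | d + 1, f => by simp only [oplusSum, mul_add, mul_oplusSum a d]

/-- A semifield is torsion-free: if `a ^ (d + 1) = 1` then `1 ⊕ a ⊕ ⋯ ⊕ a ^ d` is fixed by
multiplication by `a`. -/
theorem eq_one_of_pow_eq_one {P : Type*} [ClusterSemifield P] (a : P) (d : ℕ)
    (h : a ^ (d + 1) = 1) : a = 1 := by
  have key : ∀ m : ℕ, a * oplusSum m (fun s : Fin (m + 1) => a ^ (s : ℕ)) + 1
      = oplusSum m (fun s : Fin (m + 1) => a ^ (s : ℕ)) + a ^ (m + 1) := by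
    intro m
    induction m with
    | zero => simp [oplusSum, add_comm]
    | succ m ih =>
      have e : oplusSum (m + 1) (fun s : Fin (m + 1 + 1) => a ^ (s : ℕ))
          = oplusSum m (fun s : Fin (m + 1) => a ^ (s : ℕ)) + a ^ (m + 1) := by
        simp [oplusSum]
      rw [e, mul_add, add_right_comm, ih, ← pow_succ']
  cases d with
  | zero => simpa using h
  | succ m =>
    have e : oplusSum (m + 1) (fun s : Fin (m + 1 + 1) => a ^ (s : ℕ))
        = oplusSum m (fun s : Fin (m + 1) => a ^ (s : ℕ)) + a ^ (m + 1) := by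
      simp [oplusSum]
    have h2 : a * oplusSum (m + 1) (fun s : Fin (m + 1 + 1) => a ^ (s : ℕ))
        = oplusSum (m + 1) (fun s : Fin (m + 1 + 1) => a ^ (s : ℕ)) := by
      rw [e, mul_add, ← pow_succ', h, key m]
    exact mul_eq_right.mp h2

instance instIsMulTorsionFree {P : Type*} [ClusterSemifield P] : IsMulTorsionFree P where
  pow_left_injective m hm a b hab := by
    obtain ⟨d, rfl⟩ := Nat.exists_eq_succ_of_ne_zero hm
    have : (a / b) ^ (d + 1) = 1 := by
      rw [div_pow]; exact div_eq_one.mpr hab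
    exact div_eq_one.mp (eq_one_of_pow_eq_one _ d this)

instance instUniqueProds {P : Type*} [ClusterSemifield P] : UniqueProds P := by
  have h : TwoUniqueSums (Additive P) :=
    TwoUniqueSums.of_injective_addHom
      (⟨fun m => (m : DivisibleHull (Additive P)), fun a b => DivisibleHull.coe_add⟩ :
        AddHom (Additive P) (DivisibleHull (Additive P)))
      DivisibleHull.coe_injective inferInstance
  have h' : TwoUniqueProds (Multiplicative (Additive P)) := inferInstance
  exact (inferInstance : UniqueProds (Multiplicative (Additive P)))

/-- The group ring `ℤℙ` is a domain. -/
theorem isDomain_groupRing (P : Type*) [ClusterSemifield P] : IsDomain (MonoidAlgebra ℤ P) :=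
  inferInstance

/-- `ℚℙ`, the field of fractions of the group ring `ℤℙ`. -/
abbrev QP (P : Type*) [ClusterSemifield P] : Type _ := FractionRing (MonoidAlgebra ℤ P)

/-- The inclusion of `ℙ` (through `ℤℙ ⊂ ℚℙ`) in an extension field `K` of `ℚℙ`. -/
def coeffEmb (P : Type*) [ClusterSemifield P] (K : Type*) [Field K] [Algebra (QP P) K] :
    P →* K :=
  ((algebraMap (QP P) K).comp (algebraMap (MonoidAlgebra ℤ P) (QP P))).toMonoidHom.comp
    (MonoidAlgebra.of ℤ P)

/-- `ℙ` with a zero adjoined is a commutative semiring; polynomials with coefficients in `ℕ`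
are evaluated at elements of `ℙ` inside this semiring. -/
instance instCommSemiringWithZero {P : Type*} [ClusterSemifield P] :
    CommSemiring (WithZero P) where
  __ := (inferInstance : AddCommMonoid (WithZero P))
  __ := (inferInstance : CommMonoidWithZero (WithZero P))
  __ := (inferInstance : Distrib (WithZero P))

/-! ## Polynomials with nonnegative coefficients -/

/-- The value of a polynomial with nonnegative integer coefficients at a point of a commutative
semiring. -/
def natEval {σ R : Type*} [CommSemiring R] (v : σ → R) : MvPolynomial σ ℕ →+* R :=
  MvPolynomial.eval₂Hom (Nat.castRingHom R) v

theorem withZero_add_eq_zero {P : Type*} [ClusterSemifield P] {a b : WithZero P}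
    (h : a + b = 0) : a = 0 ∧ b = 0 := by
  induction a using WithZero.recZeroCoe with
  | zero => exact ⟨rfl, by simpa using h⟩
  | coe a =>
    induction b using WithZero.recZeroCoe with
    | zero => exact absurd h (by simp)
    | coe b => rw [← WithZero.coe_add] at h; exact absurd h WithZero.coe_ne_zero

theorem withZero_natCast_ne_zero {P : Type*} [ClusterSemifield P] {m : ℕ} (hm : m ≠ 0) :
    (m : WithZero P) ≠ 0 := by
  obtain ⟨k, rfl⟩ := Nat.exists_eq_succ_of_ne_zero hm
  intro h
  rw [Nat.succ_eq_add_one, Nat.cast_add, Nat.cast_one] at h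
  exact one_ne_zero (withZero_add_eq_zero h).2

/-- A nonzero polynomial over `ℕ` has a nonzero value at every point of `ℙ`. -/
theorem natEval_coe_ne_zero {σ P : Type*} [ClusterSemifield P] (v : σ → P)
    {p : MvPolynomial σ ℕ} (hp : p ≠ 0) : natEval (fun i => (v i : WithZero P)) p ≠ 0 := by
  classical
  obtain ⟨m, hm⟩ := MvPolynomial.ne_zero_iff.mp hp
  intro h
  have hsum : ∀ (s : Finset (σ →₀ ℕ)) (f : (σ →₀ ℕ) → WithZero P),
      ∑ i ∈ s, f i = 0 → ∀ i ∈ s, f i = 0 := by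
    intro s f
    induction s using Finset.induction_on with
    | empty => simp
    | insert a s ha ih =>
      intro h0
      rw [Finset.sum_insert ha] at h0
      obtain ⟨h1, h2⟩ := withZero_add_eq_zero h0
      intro i hi
      rcases Finset.mem_insert.mp hi with rfl | hi
      · exact h1
      · exact ih h2 i hi
  rw [natEval, MvPolynomial.coe_eval₂Hom, MvPolynomial.eval₂_eq] at h
  have h1 := hsum _ _ h m (MvPolynomial.mem_support_iff.mpr hm)
  rcases mul_eq_zero.mp h1 with h2 | h2
  · exact withZero_natCast_ne_zero hm (by simpa using h2)
  · obtain ⟨i, _, hi⟩ := Finset.prod_eq_zero_iff.mp h2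
    exact WithZero.coe_ne_zero (eq_zero_of_pow_eq_zero hi)

/-- The value in `ℙ` of a nonzero polynomial with nonnegative integer coefficients. -/
def posEval {σ P : Type*} [ClusterSemifield P] (v : σ → P) (p : MvPolynomial σ ℕ)
    (hp : p ≠ 0) : P :=
  WithZero.unzero (natEval_coe_ne_zero v hp)

/-! ## The universal semifield -/

/-- The field `ℚ(σ)` of rational functions in the variables `σ`. -/
abbrev RatField (σ : Type*) : Type _ := FractionRing (MvPolynomial σ ℤ)

/-- A polynomial with nonnegative integer coefficients as a rational function. -/
def natToRat (σ : Type*) : MvPolynomial σ ℕ →+* RatField σ :=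
  (algebraMap (MvPolynomial σ ℤ) (RatField σ)).comp (MvPolynomial.map (Nat.castRingHom ℤ))

theorem natToRat_injective (σ : Type*) : Function.Injective (natToRat σ) :=
  (IsFractionRing.injective (MvPolynomial σ ℤ) (RatField σ)).comp
    (MvPolynomial.map_injective _ Nat.cast_injective)

theorem natToRat_ne_zero {σ : Type*} {p : MvPolynomial σ ℕ} (hp : p ≠ 0) :
    natToRat σ p ≠ 0 :=
  (map_ne_zero_iff _ (natToRat_injective σ)).mpr hp

theorem natPoly_add_ne_zero {σ : Type*} {p q : MvPolynomial σ ℕ} (hp : p ≠ 0) :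
    p + q ≠ 0 := by
  obtain ⟨m, hm⟩ := MvPolynomial.ne_zero_iff.mp hp
  refine MvPolynomial.ne_zero_iff.mpr ⟨m, ?_⟩
  rw [MvPolynomial.coeff_add]
  omega

/-- The universal semifield `ℚ_sf(σ)`: the rational functions that are a quotient of two nonzero
polynomials with nonnegative integer coefficients, with the usual addition and multiplication. -/
def SFRat (σ : Type*) : Type _ :=
  {f : RatField σ // ∃ p q : MvPolynomial σ ℕ, p ≠ 0 ∧ q ≠ 0 ∧ f = natToRat σ p / natToRat σ q}

namespace SFRat

variable {σ : Type*}

/-- The underlying rational function. -/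
def val (f : SFRat σ) : RatField σ := Subtype.val f

theorem ext {f g : SFRat σ} (h : f.val = g.val) : f = g := Subtype.ext h

/-- A nonzero polynomial with nonnegative integer coefficients, as a subtraction-free rational
function. -/
def ofPoly (p : MvPolynomial σ ℕ) (hp : p ≠ 0) : SFRat σ :=
  ⟨natToRat σ p, p, 1, hp, one_ne_zero, by simp⟩

/-- The variables. -/
def X (i : σ) : SFRat σ := ofPoly (MvPolynomial.X i) (MvPolynomial.X_ne_zero i)

/-- The positive integer constants. -/
def const (m : ℕ) (hm : m ≠ 0) : SFRat σ :=
  ofPoly (MvPolynomial.C m) (by simpa using hm)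

instance : One (SFRat σ) := ⟨⟨1, 1, 1, one_ne_zero, one_ne_zero, by simp⟩⟩

instance : Mul (SFRat σ) :=
  ⟨fun f g => ⟨f.val * g.val, by
    obtain ⟨_, p, q, hp, hq, rfl⟩ := f
    obtain ⟨_, p', q', hp', hq', rfl⟩ := g
    refine ⟨p * p', q * q', mul_ne_zero hp hp', mul_ne_zero hq hq', ?_⟩
    simp only [val, map_mul, div_mul_div_comm]⟩⟩

instance : Inv (SFRat σ) :=
  ⟨fun f => ⟨f.val⁻¹, by
    obtain ⟨_, p, q, hp, hq, rfl⟩ := f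
    exact ⟨q, p, hq, hp, by simp only [val, inv_div]⟩⟩⟩

instance : Add (SFRat σ) :=
  ⟨fun f g => ⟨f.val + g.val, by
    obtain ⟨_, p, q, hp, hq, rfl⟩ := f
    obtain ⟨_, p', q', hp', hq', rfl⟩ := g
    refine ⟨p * q' + q * p', q * q', natPoly_add_ne_zero (mul_ne_zero hp hq'),
      mul_ne_zero hq hq', ?_⟩
    simp only [val, map_mul, map_add]
    rw [div_add_div _ _ (natToRat_ne_zero hq) (natToRat_ne_zero hq')]⟩⟩

theorem val_ne_zero (f : SFRat σ) : f.val ≠ 0 := by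
  obtain ⟨_, p, q, hp, hq, rfl⟩ := f
  exact div_ne_zero (natToRat_ne_zero hp) (natToRat_ne_zero hq)

instance : ClusterSemifield (SFRat σ) where
  mul_assoc f g h := ext (mul_assoc f.val g.val h.val)
  one_mul f := ext (one_mul f.val)
  mul_one f := ext (mul_one f.val)
  inv_mul_cancel f := ext (inv_mul_cancel₀ f.val_ne_zero)
  mul_comm f g := ext (mul_comm f.val g.val)
  add_assoc f g h := ext (add_assoc f.val g.val h.val)
  add_comm f g := ext (add_comm f.val g.val)
  left_distrib f g h := ext (mul_add f.val g.val h.val)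
  right_distrib f g h := ext (add_mul f.val g.val h.val)

/-- The specialization `ℚ_sf(σ) → ℙ` sending the variable `i` to `v i`: write `f = p / q` and
evaluate `p` and `q` in `ℙ`. By `specialize_eq` the result does not depend on `p`, `q`. -/
def specialize {P : Type*} [ClusterSemifield P] (v : σ → P) (f : SFRat σ) : P :=
  posEval v f.2.choose f.2.choose_spec.choose_spec.1 /
    posEval v f.2.choose_spec.choose f.2.choose_spec.choose_spec.2.1

theorem coe_posEval {P : Type*} [ClusterSemifield P] (v : σ → P) (p : MvPolynomial σ ℕ)
    (hp : p ≠ 0) :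
    ((posEval v p hp : P) : WithZero P) = natEval (fun i => (v i : WithZero P)) p :=
  WithZero.coe_unzero _

theorem cross_eq {p q p' q' : MvPolynomial σ ℕ} (hq : q ≠ 0) (hq' : q' ≠ 0)
    (h : natToRat σ p / natToRat σ q = natToRat σ p' / natToRat σ q') : p * q' = p' * q := by
  rw [div_eq_div_iff (natToRat_ne_zero hq) (natToRat_ne_zero hq'), ← map_mul, ← map_mul] at h
  exact natToRat_injective σ h

theorem specialize_eq {P : Type*} [ClusterSemifield P] (v : σ → P) (f : SFRat σ)
    (p q : MvPolynomial σ ℕ) (hp : p ≠ 0) (hq : q ≠ 0)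
    (h : f.val = natToRat σ p / natToRat σ q) :
    f.specialize v = posEval v p hp / posEval v q hq := by
  have h1 := cross_eq f.2.choose_spec.choose_spec.2.1 hq
    (f.2.choose_spec.choose_spec.2.2.symm.trans h)
  rw [specialize, div_eq_div_iff_mul_eq_mul]
  apply WithZero.coe_injective
  rw [WithZero.coe_mul, WithZero.coe_mul, coe_posEval, coe_posEval, coe_posEval, coe_posEval,
    ← map_mul, ← map_mul, h1]

open Classical in
/-- The value of a subtraction-free rational function at a point `v` of a field: write it as
`p / q` with `q` nonvanishing at `v`, and evaluate `p` and `q`. By `evalField_eq` the result does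
not depend on `p`, `q` (the value is set to `0` if there is no such expression). -/
def evalField {K : Type*} [Field K] (v : σ → K) (f : SFRat σ) : K :=
  if h : ∃ p q : MvPolynomial σ ℕ, q ≠ 0 ∧ natEval v q ≠ 0 ∧
      f.val = natToRat σ p / natToRat σ q
  then natEval v h.choose / natEval v h.choose_spec.choose else 0

theorem evalField_eq {K : Type*} [Field K] (v : σ → K) (f : SFRat σ)
    (p q : MvPolynomial σ ℕ) (hq : q ≠ 0) (hv : natEval v q ≠ 0)
    (h : f.val = natToRat σ p / natToRat σ q) :
    f.evalField v = natEval v p / natEval v q := by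
  have hex : ∃ p q : MvPolynomial σ ℕ, q ≠ 0 ∧ natEval v q ≠ 0 ∧
      f.val = natToRat σ p / natToRat σ q := ⟨p, q, hq, hv, h⟩
  obtain ⟨h0, h1, h2⟩ := hex.choose_spec.choose_spec
  rw [evalField, dif_pos hex, div_eq_div_iff h1 hv, ← map_mul, ← map_mul,
    cross_eq h0 hq (h2.symm.trans h)]

end SFRat

/-! ## The tropical semifield -/

/-- `Trop(σ)`: the free abelian group on `σ`, written multiplicatively, the addition being the
minimum of the exponents. -/
def Trop (σ : Type*) : Type _ := Multiplicative (σ →₀ ℤ)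

namespace Trop

variable {σ : Type*}

/-- The Laurent monomial with the given exponents. -/
def monomial (a : σ →₀ ℤ) : Trop σ := Multiplicative.ofAdd a

/-- The exponents of a Laurent monomial. -/
def exponents (m : Trop σ) : σ →₀ ℤ := Multiplicative.toAdd m

instance : CommGroup (Trop σ) := inferInstanceAs (CommGroup (Multiplicative (σ →₀ ℤ)))

instance : Add (Trop σ) := ⟨fun a b => monomial (a.exponents ⊓ b.exponents)⟩

theorem exponents_injective : Function.Injective (exponents (σ := σ)) :=
  fun _ _ h => Multiplicative.toAdd.injective h

theorem exponents_mul (a b : Trop σ) : (a * b).exponents = a.exponents + b.exponents := rfl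

theorem exponents_add (a b : Trop σ) : (a + b).exponents = a.exponents ⊓ b.exponents := rfl

instance : ClusterSemifield (Trop σ) where
  add_assoc a b c := exponents_injective (inf_assoc _ _ _)
  add_comm a b := exponents_injective (inf_comm _ _)
  left_distrib a b c := exponents_injective (by
    ext i
    simp [exponents_mul, exponents_add, min_add_add_left])
  right_distrib a b c := exponents_injective (by
    ext i
    simp [exponents_mul, exponents_add, min_add_add_right])

/-- The variables. -/
def X (i : σ) : Trop σ := monomial (Finsupp.single i 1)

/-- A tropical element, which is a Laurent monomial, is sent to the product of the same powers
of the given elements `v i` of an abelian group. -/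
def toMonomial {G : Type*} [CommGroup G] (v : σ → G) : Trop σ →* G where
  toFun m := m.exponents.prod fun i e => v i ^ e
  map_one' := Finsupp.prod_zero_index
  map_mul' _ _ := Finsupp.prod_add_index' (fun i => zpow_zero (v i)) fun i => zpow_add (v i)

end Trop

/-! ## Seeds and mutations -/

/-- `[b]₊ = max(b, 0)`. -/
def pos (b : ℤ) : ℤ := max b 0

/-- `B` is skew-symmetrizable: `E B` is skew-symmetric for a diagonal matrix `E` with positive
integer diagonal entries. -/
def IsSkewSymmetrizable {n : ℕ} (B : Matrix (Fin n) (Fin n) ℤ) : Prop :=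
  ∃ e : Fin n → ℤ, (∀ i, 0 < e i) ∧ ∀ i j, e i * B i j = -(e j * B j i)

/-- The data `(x, y, B)` of a seed over `ℙ`, with `x`-variables in `K`. -/
structure Seed (n : ℕ) (P K : Type*) where
  x : Fin n → K
  y : Fin n → P
  B : Matrix (Fin n) (Fin n) ℤ

/-- The data `(x, y, B, Z)` of a generalized seed over `ℙ`, with `x`-variables in `K`, where the
exchange polynomial `Z_i(u) = ∑ z_{i,s} u^s` has degree `d i` and coefficients in `ℙ`. -/
structure GenSeed (n : ℕ) (d : Fin n → ℕ) (P K : Type*) where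
  x : Fin n → K
  y : Fin n → P
  B : Matrix (Fin n) (Fin n) ℤ
  z : (i : Fin n) → Fin (d i + 1) → P

/-- The product `ŷ_k = y_k ∏ x_i ^ b_{ik}`. Here and below `ι` is the inclusion of `ℙ` in the
set `K` in which the `x`-variables live; `K` is either a field or a semifield. -/
def yhat {n : ℕ} {P K : Type*} [CommGroup P] [DivisionCommMonoid K] (ι : P →* K)
    (x : Fin n → K) (y : Fin n → P) (B : Matrix (Fin n) (Fin n) ℤ) (k : Fin n) : K :=
  ι (y k) * ∏ i, x i ^ B i k

/-- Seed mutation in direction `k`. -/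
def Seed.mutate {n : ℕ} {P K : Type*} [ClusterSemifield P] [DivisionCommMonoid K] [Add K]
    (ι : P →* K) (S : Seed n P K) (k : Fin n) : Seed n P K where
  x := Function.update S.x k
    ((S.x k)⁻¹ * (∏ i, S.x i ^ pos (-S.B i k)) *
      ((1 + yhat ι S.x S.y S.B k) / ι (1 + S.y k)))
  y := fun j => if j = k then (S.y k)⁻¹
    else S.y j * S.y k ^ pos (S.B k j) * (1 + S.y k) ^ (-S.B k j)
  B := fun i j => if i = k ∨ j = k then -S.B i j
    else S.B i j + pos (S.B i k) * S.B k j + S.B i k * pos (-S.B k j)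

/-- The value `z_0 + z_1 u + ⋯ + z_d u ^ d` of an exchange polynomial. -/
def exchangeEval {A : Type*} [Monoid A] [Add A] (d : ℕ) (z : Fin (d + 1) → A) (u : A) : A :=
  oplusSum d fun s => z s * u ^ (s : ℕ)

/-- Generalized seed mutation in direction `k`. -/
def GenSeed.mutate {n : ℕ} {d : Fin n → ℕ} {P K : Type*} [ClusterSemifield P]
    [DivisionCommMonoid K] [Add K] (ι : P →* K) (S : GenSeed n d P K) (k : Fin n) :
    GenSeed n d P K where
  x := Function.update S.x k
    ((S.x k)⁻¹ * (∏ i, S.x i ^ pos (-S.B i k)) ^ d k *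
      (exchangeEval (d k) (fun s => ι (S.z k s)) (yhat ι S.x S.y S.B k) /
        ι (exchangeEval (d k) (S.z k) (S.y k))))
  y := fun j => if j = k then (S.y k)⁻¹
    else S.y j * (S.y k ^ d k) ^ pos (S.B k j) *
      exchangeEval (d k) (S.z k) (S.y k) ^ (-S.B k j)
  B := fun i j => if i = k ∨ j = k then -S.B i j
    else S.B i j + pos (S.B i k) * d k * S.B k j + S.B i k * d k * pos (-S.B k j)
  z := Function.update S.z k fun s => S.z k s.rev

/-- The seed `Σ^t` of the cluster pattern with initial seed `S = Σ^{t₀}`. The vertex `t` of the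
`n`-regular tree is given by a sequence `k₁, …, k_m` of edge labels leading from `t₀` to `t`. -/
def Seed.atVertex {n : ℕ} {P K : Type*} [ClusterSemifield P] [DivisionCommMonoid K] [Add K]
    (ι : P →* K) (S : Seed n P K) (t : List (Fin n)) : Seed n P K :=
  t.foldl (Seed.mutate ι) S

/-- The generalized seed `Σ^t` of the generalized cluster pattern with initial generalized seed
`S = Σ^{t₀}`, vertices `t` being given as in `Seed.atVertex`. -/
def GenSeed.atVertex {n : ℕ} {d : Fin n → ℕ} {P K : Type*} [ClusterSemifield P]
    [DivisionCommMonoid K] [Add K] (ι : P →* K) (S : GenSeed n d P K) (t : List (Fin n)) :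
    GenSeed n d P K :=
  t.foldl (GenSeed.mutate ι) S

/-- The conditions on a generalized seed over `ℙ` with cluster in an extension field `K` of
`ℚℙ`: the cluster is algebraically independent over `ℚℙ`, the exchange matrix is
skew-symmetrizable, the exchange polynomials have positive degrees, and their constant and leading
coefficients are `1`. -/
structure GenSeed.IsSeed {n : ℕ} {d : Fin n → ℕ} {P K : Type*} [ClusterSemifield P] [Field K]
    [Algebra (QP P) K] (S : GenSeed n d P K) : Prop where
  algebraicIndependent : AlgebraicIndependent (QP P) S.x
  skewSymmetrizable : IsSkewSymmetrizable S.B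
  degree_pos : ∀ i, 0 < d i
  z_zero : ∀ i, S.z i 0 = 1
  z_last : ∀ i, S.z i (Fin.last (d i)) = 1

/-! ## `X`-functions, `Y`-functions, `c`-vectors, `g`-vectors and `F`-polynomials -/

/-- The indices `(i, s)`, `0 < s < d_i`, of the formal variables `z_{i,s}`. -/
def ZIndex {n : ℕ} (d : Fin n → ℕ) : Type := {p : Fin n × ℕ // 0 < p.2 ∧ p.2 < d p.1}

/-- The formal coefficients of the exchange polynomials: `z_{i,0} = z_{i,d_i} = 1`, and the other
`z_{i,s}` are the given elements. -/
def formalZ {n : ℕ} {d : Fin n → ℕ} {A : Type*} [One A] (v : ZIndex d → A) (i : Fin n)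
    (s : Fin (d i + 1)) : A :=
  if h : 0 < (s : ℕ) ∧ (s : ℕ) < d i then v ⟨(i, s), h⟩ else 1

/-- The initial generalized seed with formal variables `x`, `y`, `z` over `Trop(y, z)`; its
`x`-variables are taken in `ℚ_sf(x, y, z) ⊂ ℚ(x, y, z)`. -/
def formalSeedX {n : ℕ} (d : Fin n → ℕ) (B : Matrix (Fin n) (Fin n) ℤ) :
    GenSeed n d (Trop (Fin n ⊕ ZIndex d)) (SFRat (Fin n ⊕ (Fin n ⊕ ZIndex d))) where
  x := fun i => SFRat.X (Sum.inl i)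
  y := fun j => Trop.X (Sum.inl j)
  B := B
  z := formalZ fun p => Trop.X (Sum.inr p)

/-- The `X`-function `X^t_i ∈ ℚ_sf(x, y, z)`. -/
def XFun {n : ℕ} (d : Fin n → ℕ) (B : Matrix (Fin n) (Fin n) ℤ) (t : List (Fin n))
    (i : Fin n) : SFRat (Fin n ⊕ (Fin n ⊕ ZIndex d)) :=
  ((formalSeedX d B).atVertex (Trop.toMonomial fun a => SFRat.X (Sum.inr a)) t).x i

/-- The initial generalized seed with formal variables `y`, `z` over `ℚ_sf(y, z)`; it serves to
compute the coefficients, and its `x`-variables, which play no role, are set to `1`. -/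
def formalSeedY {n : ℕ} (d : Fin n → ℕ) (B : Matrix (Fin n) (Fin n) ℤ) :
    GenSeed n d (SFRat (Fin n ⊕ ZIndex d)) (SFRat (Fin n ⊕ ZIndex d)) where
  x := fun _ => 1
  y := fun j => SFRat.X (Sum.inl j)
  B := B
  z := formalZ fun p => SFRat.X (Sum.inr p)

/-- The `Y`-function `Y^t_j ∈ ℚ_sf(y, z)`. -/
def YFun {n : ℕ} (d : Fin n → ℕ) (B : Matrix (Fin n) (Fin n) ℤ) (t : List (Fin n))
    (j : Fin n) : SFRat (Fin n ⊕ ZIndex d) :=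
  ((formalSeedY d B).atVertex (MonoidHom.id _) t).y j

/-- The entry `c^t_{ij}` of the `c`-vector `c^t_j`: the exponent of `y_i` in the Laurent monomial
`Y^t_j|_{Trop(y, z)}`. -/
def cEntry {n : ℕ} (d : Fin n → ℕ) (B : Matrix (Fin n) (Fin n) ℤ) (t : List (Fin n))
    (i j : Fin n) : ℤ :=
  ((YFun d B t j).specialize (Trop.X (σ := Fin n ⊕ ZIndex d))).exponents (Sum.inl i)

/-- The grading `deg x_i = e_i`, `deg y_j = -b_j` (`b_j` being the `j`-th column of `B`),
`deg z_{i,s} = 0`. -/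
def varDegree {n : ℕ} (d : Fin n → ℕ) (B : Matrix (Fin n) (Fin n) ℤ) :
    Fin n ⊕ (Fin n ⊕ ZIndex d) → (Fin n → ℤ) :=
  Sum.elim (fun i => Pi.single i 1) (Sum.elim (fun j i => -B i j) fun _ => 0)

/-- The rational function `f` is homogeneous of degree `g`: it is a quotient of homogeneous
polynomials the degrees of which differ by `g`. -/
def IsHomogeneousOfDegree {σ M : Type*} [AddCommGroup M] (deg : σ → M) (f : RatField σ)
    (g : M) : Prop :=
  ∃ (p q : MvPolynomial σ ℤ) (a b : M), q ≠ 0 ∧ p.IsWeightedHomogeneous deg a ∧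
    q.IsWeightedHomogeneous deg b ∧
    f = algebraMap _ (RatField σ) p / algebraMap _ (RatField σ) q ∧ g = a - b

open Classical in
/-- The `g`-vector `g^t_j`: the degree of the homogeneous element `X^t_j`. -/
def gVector {n : ℕ} (d : Fin n → ℕ) (B : Matrix (Fin n) (Fin n) ℤ) (t : List (Fin n))
    (j : Fin n) : Fin n → ℤ :=
  if h : ∃ g, IsHomogeneousOfDegree (varDegree d B) (XFun d B t j).val g then h.choose else 0

/-- The generic `F`-polynomial `F^t_j(y, z) = X^t_j(1, y, z)`, as an element of `ℚ_sf(y, z)`. -/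
def FPoly {n : ℕ} (d : Fin n → ℕ) (B : Matrix (Fin n) (Fin n) ℤ) (t : List (Fin n))
    (j : Fin n) : SFRat (Fin n ⊕ ZIndex d) :=
  (XFun d B t j).specialize (Sum.elim (fun _ => 1) SFRat.X)

theorem choose_ne_zero {n : ℕ} {d : Fin n → ℕ} (p : ZIndex d) :
    (d p.1.1).choose p.1.2 ≠ 0 :=
  (Nat.choose_pos p.2.2.le).ne'

/-- The specialized `F`-polynomial `F^t_j(y, z^bin) ∈ ℚ_sf(y)`, where `z_{i,s}` is replaced by
the binomial coefficient `d_i choose s`. -/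
def FBin {n : ℕ} (d : Fin n → ℕ) (B : Matrix (Fin n) (Fin n) ℤ) (t : List (Fin n))
    (j : Fin n) : SFRat (Fin n) :=
  (FPoly d B t j).specialize
    (Sum.elim SFRat.X fun p => SFRat.const ((d p.1.1).choose p.1.2) (choose_ne_zero p))

/-! ## Binomial specialization of a generalized cluster pattern, and the left companion -/

/-- `y^t_j|_{z = z^bin} = ∏ y_i ^ c^t_{ij} · ∏ F^t_i|_ℙ(y, z^bin) ^ b^t_{ij}`. -/
def GenSeed.yBin {n : ℕ} {d : Fin n → ℕ} {P K : Type*} [ClusterSemifield P] [Field K]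
    [Algebra (QP P) K] (S : GenSeed n d P K) (t : List (Fin n)) (j : Fin n) : P :=
  (∏ i, S.y i ^ cEntry d S.B t i j) *
    ∏ i, (FBin d S.B t i).specialize S.y ^ (S.atVertex (coeffEmb P K) t).B i j

/-- `x^t_j|_{z = z^bin} = ∏ x_i ^ g^t_{ij} · F^t_j|_K(ŷ, z^bin) / F^t_j|_ℙ(y, z^bin)`. -/
def GenSeed.xBin {n : ℕ} {d : Fin n → ℕ} {P K : Type*} [ClusterSemifield P] [Field K]
    [Algebra (QP P) K] (S : GenSeed n d P K) (t : List (Fin n)) (j : Fin n) : K :=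
  (∏ i, S.x i ^ gVector d S.B t j i) *
    ((FBin d S.B t j).evalField (yhat (coeffEmb P K) S.x S.y S.B) /
      coeffEmb P K ((FBin d S.B t j).specialize S.y))

/-- The initial seed `(x^{1/d}, y, D B)` of the left-companion cluster algebra, where `u` is the
collection `x^{1/d}` of elements of an extension field `L`. -/
def GenSeed.leftCompanion {n : ℕ} {d : Fin n → ℕ} {P K L : Type*} (S : GenSeed n d P K)
    (u : Fin n → L) : Seed n P L where
  x := u
  y := S.y
  B := Matrix.diagonal (fun i => (d i : ℤ)) * S.B

end GenCluster

end

/-! With binomial coefficients an exchange polynomial becomes $(1+u)^{d_k}$. In the coefficient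
mutation, $(1+y_k)^{d_k}$ raised to $-b_{kj}$ is $1+y_k$ raised to $-d_kb_{kj}$, which is ordinary
mutation for the matrix $DB$. In the cluster mutation, the exchange relation is the $d_k$-th power
of the ordinary one. Reversal of $Z_k$ preserves binomial coefficients, so this persists along the
tree.

The specialized variables are not defined by mutation, so they are first identified with quantities
that mutate. Take the formal tropical pattern over $\mathrm{Trop}(\mathbf y,\mathbf z)$ and realize
its monomials with binomial $\mathbf z$ in two ways: in $\mathbb P$ with all initial $x_i=1$
(pattern `F`), and in a semifield $Q\subset\mathcal F$ with the true $x_i$ (pattern `X`). The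
cluster of `F` is the family of values $F^t_j|_{\mathbb P}$ (`FPoly_specialize`), and its $\hat y_j$
is exactly $y^t_j|_{\mathbf z^{\rm bin}}$, since `cEntry_eq` reads the $c$-vectors off the tropical
coefficients and these involve no $z$ (`isZFree_atVertex`). By homogeneity of $X^t_j$ the cluster of
`X` is $\prod_i x_i^{g_{ij}}F^t_j(\hat{\mathbf y})$ (`XFun_specialize`), so $x^t_j|_{\mathbf z^{\rm
bin}}$ is the quotient of the variable of `X` by that of `F`.

It remains to compare mutations (`leftCompanion_atVertex`). The elements $\hat y$ mutate like
coefficients (`yhat_mutate`), which settles the $y$'s; for the $x$'s the tropical denominators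
cancel in the quotient. Working in $Q$ (`exists_semifield`) keeps all evaluations subtraction-free
and hence nonzero. -/

namespace GenCluster

/-! ## Homomorphisms of semifields and specializations -/

/-- An additive and multiplicative map from a semifield to a commutative semiring, extended by
`0 ↦ 0`. -/
def liftWithZero {Q R : Type*} [ClusterSemifield Q] [CommSemiring R] (g : Q →* R)
    (hg : ∀ a b, g (a + b) = g a + g b) : WithZero Q →+* R where
  toFun a := WithZero.recZeroCoe (motive := fun _ => R) 0 g a
  map_zero' := rfl
  map_one' := map_one g
  map_add' a b := by
    induction a using WithZero.recZeroCoe with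
    | zero => exact (congrArg _ (zero_add b)).trans (zero_add _).symm
    | coe a =>
      induction b using WithZero.recZeroCoe with
      | zero => exact (congrArg _ (add_zero (a : WithZero Q))).trans (add_zero _).symm
      | coe b => exact hg a b
  map_mul' a b := by
    induction a using WithZero.recZeroCoe with
    | zero => exact (congrArg _ (zero_mul b)).trans (zero_mul _).symm
    | coe a =>
      induction b using WithZero.recZeroCoe with
      | zero => exact (congrArg _ (mul_zero (a : WithZero Q))).trans (mul_zero _).symm
      | coe b => exact map_mul g a b

theorem map_natEval {σ R R' : Type*} [CommSemiring R] [CommSemiring R'] (f : R →+* R')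
    (v : σ → R) (p : MvPolynomial σ ℕ) : f (natEval v p) = natEval (fun i => f (v i)) p := by
  have : f.comp (natEval v) = natEval (fun i => f (v i)) := by
    apply MvPolynomial.ringHom_ext
    · intro r; simp [natEval]
    · intro i; simp [natEval]
  exact DFunLike.congr_fun this p

/-- A semiring as target serves two cases: homomorphisms into another semifield, through `WithZero`,
and inclusions into a field. -/
theorem map_posEval_eq_natEval {σ Q R : Type*} [ClusterSemifield Q] [CommSemiring R] (g : Q →* R)
    (hg : ∀ a b, g (a + b) = g a + g b) (v : σ → Q) (p : MvPolynomial σ ℕ) (hp : p ≠ 0) :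
    g (posEval v p hp) = natEval (fun i => g (v i)) p :=
  (congrArg (liftWithZero g hg) (SFRat.coe_posEval v p hp)).trans
    (map_natEval (liftWithZero g hg) _ p)

theorem map_posEval {σ Q P : Type*} [ClusterSemifield Q] [ClusterSemifield P] (f : Q →* P)
    (hf : ∀ a b, f (a + b) = f a + f b) (v : σ → Q) (p : MvPolynomial σ ℕ) (hp : p ≠ 0) :
    f (posEval v p hp) = posEval (fun i => f (v i)) p hp := by
  apply WithZero.coe_injective
  rw [SFRat.coe_posEval]
  exact map_posEval_eq_natEval ((WithZero.coeMonoidHom : P →* WithZero P).comp f)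
    (fun a b => congrArg _ (hf a b)) v p hp

theorem posEval_mul {σ P : Type*} [ClusterSemifield P] (v : σ → P) (p q : MvPolynomial σ ℕ)
    (hp : p ≠ 0) (hq : q ≠ 0) :
    posEval v (p * q) (mul_ne_zero hp hq) = posEval v p hp * posEval v q hq := by
  apply WithZero.coe_injective
  simp only [SFRat.coe_posEval, WithZero.coe_mul, map_mul]

theorem posEval_add {σ P : Type*} [ClusterSemifield P] (v : σ → P) (p q : MvPolynomial σ ℕ)
    (hp : p ≠ 0) (hq : q ≠ 0) :
    posEval v (p + q) (natPoly_add_ne_zero hp) = posEval v p hp + posEval v q hq := by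
  apply WithZero.coe_injective
  simp only [SFRat.coe_posEval, WithZero.coe_add, map_add]

/-! ### Specialization as a homomorphism, and the universal property of the universal semifield -/

namespace SFRat

variable {σ : Type*}

theorem exists_rep (f : SFRat σ) : ∃ p q : MvPolynomial σ ℕ, p ≠ 0 ∧ q ≠ 0 ∧
    f.val = natToRat σ p / natToRat σ q := f.2

/-- The underlying rational function, as a homomorphism. -/
noncomputable def valHom (σ : Type*) : SFRat σ →* RatField σ where
  toFun := val
  map_one' := rfl
  map_mul' _ _ := rfl

theorem specialize_mul {P : Type*} [ClusterSemifield P] (v : σ → P) (f g : SFRat σ) :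
    (f * g).specialize v = f.specialize v * g.specialize v := by
  obtain ⟨p, q, hp, hq, h⟩ := f.exists_rep
  obtain ⟨p', q', hp', hq', h'⟩ := g.exists_rep
  rw [specialize_eq v f p q hp hq h, specialize_eq v g p' q' hp' hq' h',
    specialize_eq v (f * g) (p * p') (q * q') (mul_ne_zero hp hp') (mul_ne_zero hq hq'),
    posEval_mul v _ _ hp hp', posEval_mul v _ _ hq hq', div_mul_div_comm]
  rw [map_mul, map_mul, ← div_mul_div_comm, ← h, ← h']
  rfl

theorem specialize_add {P : Type*} [ClusterSemifield P] (v : σ → P) (f g : SFRat σ) :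
    (f + g).specialize v = f.specialize v + g.specialize v := by
  obtain ⟨p, q, hp, hq, h⟩ := f.exists_rep
  obtain ⟨p', q', hp', hq', h'⟩ := g.exists_rep
  rw [specialize_eq v f p q hp hq h, specialize_eq v g p' q' hp' hq' h',
    specialize_eq v (f + g) (p * q' + q * p') (q * q')
      (natPoly_add_ne_zero (mul_ne_zero hp hq')) (mul_ne_zero hq hq'),
    posEval_add v _ _ (mul_ne_zero hp hq') (mul_ne_zero hq hp'), posEval_mul v _ _ hp hq',
    posEval_mul v _ _ hq hp', posEval_mul v _ _ hq hq']
  · rw [div_eq_mul_inv, add_mul, ← div_eq_mul_inv, ← div_eq_mul_inv, mul_div_mul_left_eq_div,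
      mul_div_mul_right_eq_div]
  · rw [map_add, map_mul, map_mul, map_mul,
      ← div_add_div _ _ (natToRat_ne_zero hq) (natToRat_ne_zero hq'), ← h, ← h']
    rfl

/-- Specialization as a homomorphism. -/
noncomputable def specializeHom {P : Type*} [ClusterSemifield P] (v : σ → P) : SFRat σ →* P :=
  MonoidHom.mk' (specialize v) (specialize_mul v)

@[simp] theorem specializeHom_apply {P : Type*} [ClusterSemifield P] (v : σ → P) (f : SFRat σ) :
    specializeHom v f = f.specialize v := rfl

theorem specializeHom_add {P : Type*} [ClusterSemifield P] (v : σ → P) (f g : SFRat σ) :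
    specializeHom v (f + g) = specializeHom v f + specializeHom v g := specialize_add v f g

theorem specialize_ofPoly {P : Type*} [ClusterSemifield P] (v : σ → P) (p : MvPolynomial σ ℕ)
    (hp : p ≠ 0) : (ofPoly p hp).specialize v = posEval v p hp := by
  rw [specialize_eq v _ p 1 hp one_ne_zero]
  · have : posEval v (1 : MvPolynomial σ ℕ) one_ne_zero = 1 := by
      apply WithZero.coe_injective
      rw [coe_posEval, map_one, WithZero.coe_one]
    rw [this, div_one]
  · rw [map_one, div_one]; rfl

@[simp] theorem specialize_X {P : Type*} [ClusterSemifield P] (v : σ → P) (i : σ) :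
    (X i).specialize v = v i := by
  rw [X, specialize_ofPoly]
  apply WithZero.coe_injective
  rw [coe_posEval]
  simp [natEval]

theorem posEval_X (p : MvPolynomial σ ℕ) (hp : p ≠ 0) : posEval X p hp = ofPoly p hp := by
  apply ext
  have h := map_posEval_eq_natEval (valHom σ) (fun _ _ => rfl) X p hp
  refine h.trans ?_
  change _ = natToRat σ p
  have : natEval (fun i => valHom σ (X i)) = natToRat σ := by
    apply MvPolynomial.ringHom_ext
    · intro r; simp [natEval]
    · intro i
      rw [natEval, MvPolynomial.coe_eval₂Hom, MvPolynomial.eval₂_X]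
      rfl
  rw [this]

/-- This reduces the universal property to `map_posEval`: an additive homomorphism is determined on
a quotient of polynomials by its values on the variables. -/
theorem specialize_self (f : SFRat σ) : f.specialize X = f := by
  obtain ⟨p, q, hp, hq, h⟩ := f.exists_rep
  rw [specialize_eq X f p q hp hq h, posEval_X, posEval_X]
  apply ext
  rw [div_eq_mul_inv, h, div_eq_mul_inv]
  rfl

/-- The universal property of the universal semifield. -/
theorem map_eq_specialize {P : Type*} [ClusterSemifield P] (F : SFRat σ →* P)
    (hF : ∀ a b, F (a + b) = F a + F b) (f : SFRat σ) :
    F f = f.specialize fun i => F (X i) := by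
  obtain ⟨p, q, hp, hq, h⟩ := f.exists_rep
  rw [specialize_eq _ f p q hp hq h, ← map_posEval F hF, ← map_posEval F hF, ← map_div,
    ← specialize_eq X f p q hp hq h, specialize_self]

theorem map_specialize {P Q : Type*} [ClusterSemifield P] [ClusterSemifield Q] (F : P →* Q)
    (hF : ∀ a b, F (a + b) = F a + F b) (v : σ → P) (f : SFRat σ) :
    F (f.specialize v) = f.specialize fun i => F (v i) := by
  have := map_eq_specialize (F.comp (specializeHom v))
    (fun a b => by simp [specialize_add, hF]) f
  simpa using this

theorem specialize_specialize {τ P : Type*} [ClusterSemifield P] (v : σ → SFRat τ) (w : τ → P)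
    (f : SFRat σ) : (f.specialize v).specialize w = f.specialize fun i => (v i).specialize w :=
  map_specialize (specializeHom w) (specializeHom_add w) v f

/-- Evaluation in a field, at a point with coordinates in a semifield contained in it. -/
theorem evalField_map {Q K : Type*} [ClusterSemifield Q] [Field K] (g : Q →* K)
    (hg : ∀ a b, g (a + b) = g a + g b) (v : σ → Q) (f : SFRat σ) :
    f.evalField (fun i => g (v i)) = g (f.specialize v) := by
  obtain ⟨p, q, hp, hq, h⟩ := f.exists_rep
  rw [specialize_eq v f p q hp hq h, evalField_eq (fun i => g (v i)) f p q hq _ h, map_div,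
    map_posEval_eq_natEval g hg, map_posEval_eq_natEval g hg]
  rw [← map_posEval_eq_natEval g hg v q hq]
  -- Every element of `Q` is invertible, so its image in the field is nonzero; hence no denominator
  -- vanishes at such a point.
  exact ((Group.isUnit (posEval v q hq)).map g).ne_zero

end SFRat

/-! ### Positive integer constants and the binomial theorem in a semifield -/

/-- The constant `m` of a semifield. -/
noncomputable def posNat (P : Type*) [ClusterSemifield P] (m : ℕ) (hm : m ≠ 0) : P :=
  WithZero.unzero (withZero_natCast_ne_zero (P := P) hm)

theorem coe_posNat (P : Type*) [ClusterSemifield P] (m : ℕ) (hm : m ≠ 0) :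
    ((posNat P m hm : P) : WithZero P) = m := WithZero.coe_unzero _

theorem posNat_one (P : Type*) [ClusterSemifield P] : posNat P 1 one_ne_zero = 1 := by
  apply WithZero.coe_injective
  rw [coe_posNat, Nat.cast_one, WithZero.coe_one]

theorem SFRat.specialize_const {σ P : Type*} [ClusterSemifield P] (v : σ → P) (m : ℕ)
    (hm : m ≠ 0) : (SFRat.const m hm).specialize v = posNat P m hm := by
  rw [SFRat.const, SFRat.specialize_ofPoly]
  apply WithZero.coe_injective
  rw [SFRat.coe_posEval, coe_posNat]
  simp [natEval]

theorem coe_oplusSum {P : Type*} [ClusterSemifield P] : ∀ (d : ℕ) (f : Fin (d + 1) → P),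
    ((oplusSum d f : P) : WithZero P) = ∑ s, (f s : WithZero P)
  | 0, f => by simp [oplusSum]
  | d + 1, f => by
    rw [oplusSum, WithZero.coe_add, coe_oplusSum d, Fin.sum_univ_castSucc (n := d + 1)]

/-- The binomial theorem in a semifield. -/
theorem exchangeEval_choose {P : Type*} [ClusterSemifield P] (d : ℕ) (u : P) :
    exchangeEval d (fun s => posNat P (d.choose s) (Nat.choose_pos s.is_le).ne') u
      = (1 + u) ^ d := by
  apply WithZero.coe_injective
  rw [exchangeEval, coe_oplusSum, WithZero.coe_pow, WithZero.coe_add, WithZero.coe_one,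
    add_comm (1 : WithZero P),    add_pow, Finset.sum_range]
  refine Finset.sum_congr rfl fun s _ => ?_
  rw [WithZero.coe_mul, coe_posNat, WithZero.coe_pow, one_pow, mul_one, mul_comm]

theorem map_oplusSum {A A' : Type*} [Add A] [Add A'] (f : A → A')
    (hf : ∀ a b, f (a + b) = f a + f b) : ∀ (d : ℕ) (g : Fin (d + 1) → A),
    f (oplusSum d g) = oplusSum d fun s => f (g s)
  | 0, _ => rfl
  | d + 1, g => by rw [oplusSum, hf, map_oplusSum f hf d]; rfl

theorem map_exchangeEval {A A' : Type*} [Monoid A] [Add A] [Monoid A'] [Add A'] (f : A →* A')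
    (hf : ∀ a b, f (a + b) = f a + f b) (d : ℕ) (z : Fin (d + 1) → A) (u : A) :
    f (exchangeEval d z u) = exchangeEval d (fun s => f (z s)) (f u) := by
  rw [exchangeEval, map_oplusSum f hf, exchangeEval]
  simp only [map_mul, map_pow]

/-! ## Mutation: functoriality and the variables `ŷ` -/

namespace GenSeed

variable {n : ℕ} {d : Fin n → ℕ} {P P' K K' : Type*}

theorem atVertex_concat [ClusterSemifield P] [DivisionCommMonoid K] [Add K] (ι : P →* K)
    (S : GenSeed n d P K) (t : List (Fin n)) (k : Fin n) :
    S.atVertex ι (t ++ [k]) = (S.atVertex ι t).mutate ι k := by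
  simp [atVertex, List.foldl_append]

/-- The image of a generalized seed under maps of its coefficients and of its variables. -/
def map (f : P → P') (g : K → K') (S : GenSeed n d P K) : GenSeed n d P' K' where
  x := fun i => g (S.x i)
  y := fun i => f (S.y i)
  B := S.B
  z := fun i s => f (S.z i s)

/-- Mutation uses only products, inverses, sums and the inclusion of coefficients, all of which `f`
and `g` respect. -/
theorem map_mutate [ClusterSemifield P] [ClusterSemifield P'] [ClusterSemifield K]
    [ClusterSemifield K'] (ι : P →* K) (ι' : P' →* K') (f : P →* P') (g : K →* K')
    (hf : ∀ a b, f (a + b) = f a + f b) (hg : ∀ a b, g (a + b) = g a + g b)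
    (h : ∀ p, g (ι p) = ι' (f p)) (S : GenSeed n d P K) (k : Fin n) :
    (S.mutate ι k).map f g = (S.map f g).mutate ι' k := by
  have hy : ∀ j, g (yhat ι S.x S.y S.B j)
      = yhat ι' (fun i => g (S.x i)) (fun i => f (S.y i)) S.B j := by
    intro j
    simp only [yhat, map_mul, h, map_prod, map_zpow]
  have hext : ∀ S S' : GenSeed n d P' K', S.x = S'.x → S.y = S'.y → S.B = S'.B → S.z = S'.z →
      S = S' := by
    rintro ⟨⟩ ⟨⟩ rfl rfl rfl rfl; rfl
  refine hext _ _ ?_ ?_ rfl ?_ <;> simp only [mutate, map]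
  · funext i
    by_cases hi : i = k
    · subst hi
      simp only [Function.update_self, map_mul, map_div, map_inv, map_pow, map_prod, map_zpow,
        map_exchangeEval g hg, map_exchangeEval f hf, h, hy]
    · simp only [Function.update_of_ne hi]
  · funext j
    split_ifs with hj
    · rw [map_inv]
    · simp only [map_mul, map_zpow, map_pow, map_exchangeEval f hf]
  · funext i s
    by_cases hi : i = k
    · subst hi
      simp only [Function.update_self]
    · simp only [Function.update_of_ne hi]

theorem map_atVertex [ClusterSemifield P] [ClusterSemifield P'] [ClusterSemifield K]
    [ClusterSemifield K'] (ι : P →* K) (ι' : P' →* K') (f : P →* P') (g : K →* K')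
    (hf : ∀ a b, f (a + b) = f a + f b) (hg : ∀ a b, g (a + b) = g a + g b)
    (h : ∀ p, g (ι p) = ι' (f p)) (S : GenSeed n d P K) (t : List (Fin n)) :
    (S.atVertex ι t).map f g = (S.map f g).atVertex ι' t := by
  induction t using List.reverseRecOn with
  | nil => rfl
  | append_singleton t k ih =>
    rw [atVertex_concat, atVertex_concat, map_mutate ι ι' f g hf hg h, ih]

/-- The exchange matrices of a pattern depend only on the initial one. -/
theorem atVertex_B_congr [ClusterSemifield P] [DivisionCommMonoid K] [Add K]
    [ClusterSemifield P'] [DivisionCommMonoid K'] [Add K'] (ι : P →* K) (ι' : P' →* K')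
    (S : GenSeed n d P K) (S' : GenSeed n d P' K') (hB : S.B = S'.B) (t : List (Fin n)) :
    (S.atVertex ι t).B = (S'.atVertex ι' t).B := by
  induction t using List.reverseRecOn with
  | nil => exact hB
  | append_singleton t k ih =>
    rw [atVertex_concat, atVertex_concat]
    simp only [mutate, ih]
    rfl

/-- The coefficients and exchange polynomials of a pattern do not depend on the cluster. -/
theorem atVertex_congr [ClusterSemifield P] [DivisionCommMonoid K] [Add K]
    [DivisionCommMonoid K'] [Add K'] (ι : P →* K) (ι' : P →* K')
    (S : GenSeed n d P K) (S' : GenSeed n d P K') (hB : S.B = S'.B) (hy : S.y = S'.y)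
    (hz : S.z = S'.z) (t : List (Fin n)) :
    (S.atVertex ι t).B = (S'.atVertex ι' t).B ∧ (S.atVertex ι t).y = (S'.atVertex ι' t).y ∧
      (S.atVertex ι t).z = (S'.atVertex ι' t).z := by
  induction t using List.reverseRecOn with
  | nil => exact ⟨hB, hy, hz⟩
  | append_singleton t k ih =>
    rw [atVertex_concat, atVertex_concat]
    obtain ⟨h1, h2, h3⟩ := ih
    simp only [mutate, h1, h2, h3, and_true]
    rfl

/-- The same symmetrizer `e` works after mutation, because $e_i[b_{ik}]_+=e_k[-b_{ki}]_+$. Only the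
vanishing of the diagonal is needed later. -/
theorem isSkewSymmetrizable_mutate [ClusterSemifield P] [DivisionCommMonoid K] [Add K]
    (ι : P →* K) (S : GenSeed n d P K) (hS : IsSkewSymmetrizable S.B) (k : Fin n) :
    IsSkewSymmetrizable (S.mutate ι k).B := by
  obtain ⟨e, he, hB⟩ := hS
  refine ⟨e, he, fun i j => ?_⟩
  have posmul : ∀ a b : ℤ, 0 < a → a * pos b = pos (a * b) := by
    intro a b ha
    rw [pos, pos, mul_max_of_nonneg _ _ ha.le, mul_zero]
  simp only [mutate]
  by_cases h : i = k ∨ j = k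
  · rw [if_pos h, if_pos h.symm]
    linarith [hB i j]
  · rw [if_neg h, if_neg (fun h' => h h'.symm)]
    have h1 : e i * pos (S.B i k) = e k * pos (-S.B k i) := by
      rw [posmul _ _ (he i), posmul _ _ (he k), hB i k, mul_neg]
    have h2 : e j * pos (S.B j k) = e k * pos (-S.B k j) := by
      rw [posmul _ _ (he j), posmul _ _ (he k), hB j k, mul_neg]
    have h3 := hB i k
    have h4 := hB j k
    linear_combination hB i j + d k * S.B k j * h1 + d k * S.B k i * h2
      + d k * pos (-S.B k j) * h3 + d k * pos (-S.B k i) * h4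

theorem isSkewSymmetrizable_atVertex [ClusterSemifield P] [DivisionCommMonoid K] [Add K]
    (ι : P →* K) (S : GenSeed n d P K) (hS : IsSkewSymmetrizable S.B) (t : List (Fin n)) :
    IsSkewSymmetrizable (S.atVertex ι t).B := by
  induction t using List.reverseRecOn with
  | nil => exact hS
  | append_singleton t k ih =>
    rw [atVertex_concat]
    exact isSkewSymmetrizable_mutate ι _ ih k

theorem _root_.GenCluster.IsSkewSymmetrizable.diag {B : Matrix (Fin n) (Fin n) ℤ}
    (hB : IsSkewSymmetrizable B) (k : Fin n) : B k k = 0 := by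
  obtain ⟨e, he, h⟩ := hB
  have := h k k
  have h2 : e k * B k k = 0 := by linarith
  exact (mul_eq_zero.mp h2).resolve_left (he k).ne'

/-- The elements `ŷ` mutate like coefficients. -/
theorem yhat_mutate [ClusterSemifield P] [ClusterSemifield K] (ι : P →* K)
    (S : GenSeed n d P K) (k : Fin n) (hk : S.B k k = 0) (j : Fin n) :
    yhat ι (S.mutate ι k).x (S.mutate ι k).y (S.mutate ι k).B j =
      if j = k then (yhat ι S.x S.y S.B k)⁻¹
      else yhat ι S.x S.y S.B j * (yhat ι S.x S.y S.B k ^ d k) ^ pos (S.B k j) *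
        exchangeEval (d k) (fun s => ι (S.z k s)) (yhat ι S.x S.y S.B k) ^ (-S.B k j) := by
  split_ifs with hj
  · subst hj
    simp only [yhat, mutate, if_true, or_true, mul_inv, map_inv, ← Finset.prod_inv_distrib]
    congr 1
    refine Finset.prod_congr rfl fun i _ => ?_
    by_cases hi : i = j
    · subst hi; simp [hk]
    · rw [Function.update_of_ne hi, zpow_neg]
  · set E := exchangeEval (d k) (fun s => ι (S.z k s)) (yhat ι S.x S.y S.B k) with hE
    set E' := exchangeEval (d k) (S.z k) (S.y k) with hE'
    set M := ∏ i, S.x i ^ pos (-S.B i k) with hM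
    -- Only the factor $i=k$ involves the new variable. Its part $x_k^{-1}$ raised to $-b_{kj}$
    -- gives $x_k^{b_{kj}}$, which fits the general exponent because $b_{kk}=0$.
    have hprod : ∏ i, (S.mutate ι k).x i ^ (S.mutate ι k).B i j =
        (∏ i, S.x i ^ (S.B i j + pos (S.B i k) * d k * S.B k j
          + S.B i k * d k * pos (-S.B k j))) * (M ^ d k * (E / ι E')) ^ (-S.B k j) := by
      have : (M ^ d k * (E / ι E')) ^ (-S.B k j)
          = ∏ i, if i = k then (M ^ d k * (E / ι E')) ^ (-S.B k j) else 1 := by simp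
      rw [this, ← Finset.prod_mul_distrib]
      refine Finset.prod_congr rfl fun i _ => ?_
      by_cases hi : i = k
      · subst hi
        simp only [mutate, Function.update_self, true_or, if_true, hk]
        rw [mul_assoc, mul_zpow, ← hM, ← hE, ← hE', inv_zpow', neg_neg]
        simp [pos]
      · simp only [mutate, Function.update_of_ne hi, mul_one, hi, hj, or_self,
          if_false]
    -- Both sides have the same exponent of each $x_i$, by $[b]_+-[-b]_+=b$ applied to $b_{ik}$ and
    -- to $b_{kj}$.
    have hx : (∏ i, S.x i ^ (S.B i j + pos (S.B i k) * d k * S.B k j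
          + S.B i k * d k * pos (-S.B k j))) * (M ^ d k) ^ (-S.B k j)
        = (∏ i, S.x i ^ S.B i j) * ((∏ i, S.x i ^ S.B i k) ^ d k) ^ pos (S.B k j) := by
      rw [hM, ← Finset.prod_pow, ← Finset.prod_zpow, ← Finset.prod_pow, ← Finset.prod_zpow,
        ← Finset.prod_mul_distrib, ← Finset.prod_mul_distrib]
      refine Finset.prod_congr rfl fun i _ => ?_
      simp only [← zpow_natCast, ← zpow_mul, ← zpow_add]
      congr 1
      have hp : ∀ b : ℤ, pos b - pos (-b) = b := by
        intro b; simp only [pos]; omega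
      linear_combination (d k * S.B k j) * hp (S.B i k) - (S.B i k * d k) * hp (S.B k j)
    rw [yhat, hprod, mul_zpow, ← mul_assoc (∏ i, _), hx]
    have hy : (S.mutate ι k).y j = S.y j * (S.y k ^ d k) ^ pos (S.B k j) * E' ^ (-S.B k j) := by
      simp only [mutate, if_neg hj, hE']
    rw [hy]
    simp only [map_mul, map_zpow, map_pow, yhat, mul_zpow, mul_pow, div_zpow]
    rw [div_eq_mul_inv]
    set a := ι E' ^ (-S.B k j)
    generalize E ^ (-S.B k j) = b
    generalize ((∏ i, S.x i ^ S.B i k) ^ d k) ^ pos (S.B k j) = c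
    generalize (∏ i, S.x i ^ S.B i j) = e
    generalize (ι (S.y k) ^ d k) ^ pos (S.B k j) = g
    calc _ = ι (S.y j) * e * (g * c) * b * (a * a⁻¹) := by ac_rfl
      _ = _ := by rw [mul_inv_cancel, mul_one]

end GenSeed

universe v

/-! ## The semifield of positive elements of a field -/

/-- The fractions of elements of a subring `φ(R)` that have positive image under a homomorphism
`ε : R → ℤ`. -/
def PosFrac {R K : Type*} [CommRing R] [Field K] (φ : R →+* K) (_hφ : Function.Injective φ)
    (ε : R →+* ℤ) : Type _ :=
  {k : K // ∃ a b : R, 0 < ε a ∧ 0 < ε b ∧ k = φ a / φ b}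

namespace PosFrac

variable {R K : Type*} [CommRing R] [Field K] {φ : R →+* K} {hφ : Function.Injective φ}
  {ε : R →+* ℤ}

theorem map_ne_zero_of_pos (hφ : Function.Injective φ) {a : R} (ha : 0 < ε a) : φ a ≠ 0 := by
  rw [map_ne_zero_iff _ hφ]
  rintro rfl
  simp at ha

/-- The underlying element of the field. -/
def val (f : PosFrac φ hφ ε) : K := Subtype.val f

theorem ext {f g : PosFrac φ hφ ε} (h : f.val = g.val) : f = g := Subtype.ext h

/-- An element of `R` with positive image in `ℤ`. -/
def of (hφ : Function.Injective φ) (a : R) (ha : 0 < ε a) : PosFrac φ hφ ε :=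
  ⟨φ a, a, 1, ha, by simp, by simp⟩

instance : One (PosFrac φ hφ ε) := ⟨⟨1, 1, 1, by simp, by simp, by simp⟩⟩

instance : Mul (PosFrac φ hφ ε) :=
  ⟨fun f g => ⟨f.val * g.val, by
    obtain ⟨_, a, b, ha, hb, rfl⟩ := f
    obtain ⟨_, a', b', ha', hb', rfl⟩ := g
    refine ⟨a * a', b * b', by rw [map_mul]; positivity, by rw [map_mul]; positivity, ?_⟩
    simp only [val, map_mul, div_mul_div_comm]⟩⟩

instance : Inv (PosFrac φ hφ ε) :=
  ⟨fun f => ⟨f.val⁻¹, by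
    obtain ⟨_, a, b, ha, hb, rfl⟩ := f
    exact ⟨b, a, hb, ha, by simp only [val, inv_div]⟩⟩⟩

instance : Add (PosFrac φ hφ ε) :=
  ⟨fun f g => ⟨f.val + g.val, by
    obtain ⟨_, a, b, ha, hb, rfl⟩ := f
    obtain ⟨_, a', b', ha', hb', rfl⟩ := g
    refine ⟨a * b' + b * a', b * b', by simp only [map_add, map_mul]; positivity,
      by rw [map_mul]; positivity, ?_⟩
    simp only [val, map_mul, map_add]
    rw [div_add_div _ _ (map_ne_zero_of_pos hφ hb) (map_ne_zero_of_pos hφ hb')]⟩⟩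

theorem val_ne_zero (f : PosFrac φ hφ ε) : f.val ≠ 0 := by
  obtain ⟨_, a, b, ha, hb, rfl⟩ := f
  exact div_ne_zero (map_ne_zero_of_pos hφ ha) (map_ne_zero_of_pos hφ hb)

instance : ClusterSemifield (PosFrac φ hφ ε) where
  mul_assoc f g h := ext (mul_assoc f.val g.val h.val)
  one_mul f := ext (one_mul f.val)
  mul_one f := ext (mul_one f.val)
  inv_mul_cancel f := ext (inv_mul_cancel₀ f.val_ne_zero)
  mul_comm f g := ext (mul_comm f.val g.val)
  add_assoc f g h := ext (add_assoc f.val g.val h.val)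
  add_comm f g := ext (add_comm f.val g.val)
  left_distrib f g h := ext (mul_add f.val g.val h.val)
  right_distrib f g h := ext (add_mul f.val g.val h.val)

/-- The inclusion in the field. -/
def valHom : PosFrac φ hφ ε →* K where
  toFun := val
  map_one' := rfl
  map_mul' _ _ := rfl

end PosFrac


/-- A field extension `K` of `ℚℙ` with algebraically independent elements `x` contains a semifield
that contains `ℙ` and `x`. -/
theorem exists_semifield {P : Type*} {K : Type v} [ClusterSemifield P] [Field K]
    [Algebra (QP P) K] {n : ℕ} (x : Fin n → K) (hx : AlgebraicIndependent (QP P) x) :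
    ∃ (Q : Type v) (_ : ClusterSemifield Q) (g : Q →* K) (ι : P →* Q) (x' : Fin n → Q),
      (∀ a b, g (a + b) = g a + g b) ∧ (∀ p, g (ι p) = coeffEmb P K p) ∧ ∀ i, g (x' i) = x i := by
  set A := algebraMap (MonoidAlgebra ℤ P) (QP P)
  set φ : MvPolynomial (Fin n) (MonoidAlgebra ℤ P) →+* K :=
    ((MvPolynomial.aeval x : MvPolynomial (Fin n) (QP P) →ₐ[QP P] K) :
      MvPolynomial (Fin n) (QP P) →+* K).comp (MvPolynomial.map A) with hφdef
  have hx' : Function.Injective (MvPolynomial.aeval x : MvPolynomial (Fin n) (QP P) →ₐ[QP P] K) :=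
    hx
  -- Algebraic independence enters here: a polynomial with positive image under `ε` is nonzero, so
  -- its value in `K` is nonzero too.
  have hφ : Function.Injective φ :=
    hx'.comp (MvPolynomial.map_injective _ (IsFractionRing.injective _ _))
  -- The augmentation sends every element of $\mathbb P$ and every variable to 1. Positivity of `ε`
  -- is stable under sums and products.
  set ε : MvPolynomial (Fin n) (MonoidAlgebra ℤ P) →+* ℤ :=
    MvPolynomial.eval₂Hom ((MonoidAlgebra.lift ℤ ℤ P 1 : MonoidAlgebra ℤ P →ₐ[ℤ] ℤ) :
      MonoidAlgebra ℤ P →+* ℤ) (fun _ => 1) with hεdef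
  have hε : ∀ p : P, ε (MvPolynomial.C (MonoidAlgebra.of ℤ P p)) = 1 := by
    intro p; simp [hεdef]
  have hεX : ∀ i, ε (MvPolynomial.X i) = 1 := by
    intro i; simp [hεdef]
  have hφC : ∀ p : P, φ (MvPolynomial.C (MonoidAlgebra.of ℤ P p)) = coeffEmb P K p := by
    intro p
    simp [hφdef, coeffEmb, A]
  refine ⟨PosFrac φ hφ ε, inferInstance, PosFrac.valHom,
    MonoidHom.mk' (fun p => PosFrac.of hφ (MvPolynomial.C (MonoidAlgebra.of ℤ P p))
      (by rw [hε]; exact one_pos)) fun p q => PosFrac.ext ?_,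
    fun i => PosFrac.of hφ (MvPolynomial.X i) (by rw [hεX]; exact one_pos),
    fun _ _ => rfl, hφC, fun i => ?_⟩
  · change φ _ = φ _ * φ _
    rw [map_mul, map_mul, map_mul]
  · change φ _ = _
    simp [hφdef]

/-! ## Homogeneous elements -/

section Homogeneous

variable {σ M : Type*} [AddCommGroup M] (deg : σ → M)

theorem isHomogeneousOfDegree_one : IsHomogeneousOfDegree deg (1 : RatField σ) 0 :=
  ⟨1, 1, 0, 0, one_ne_zero, MvPolynomial.isWeightedHomogeneous_one _ _,
    MvPolynomial.isWeightedHomogeneous_one _ _, by simp, by simp⟩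

theorem isHomogeneousOfDegree_X (i : σ) :
    IsHomogeneousOfDegree deg (SFRat.X i).val (deg i) :=
  ⟨MvPolynomial.X i, 1, deg i, 0, one_ne_zero, MvPolynomial.isWeightedHomogeneous_X _ _ _,
    MvPolynomial.isWeightedHomogeneous_one _ _,
    by simp [SFRat.X, SFRat.ofPoly, SFRat.val, natToRat], by simp⟩

variable {deg}

theorem IsHomogeneousOfDegree.mul {f f' : RatField σ} {g g' : M}
    (h : IsHomogeneousOfDegree deg f g) (h' : IsHomogeneousOfDegree deg f' g') :
    IsHomogeneousOfDegree deg (f * f') (g + g') := by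
  obtain ⟨p, q, a, b, hq, hpa, hqb, rfl, rfl⟩ := h
  obtain ⟨p', q', a', b', hq', hpa', hqb', rfl, rfl⟩ := h'
  refine ⟨p * p', q * q', a + a', b + b', mul_ne_zero hq hq', hpa.mul hpa', hqb.mul hqb', ?_, ?_⟩
  · rw [map_mul, map_mul, div_mul_div_comm]
  · abel

theorem IsHomogeneousOfDegree.inv {f : RatField σ} {g : M} (hf : f ≠ 0)
    (h : IsHomogeneousOfDegree deg f g) : IsHomogeneousOfDegree deg f⁻¹ (-g) := by
  obtain ⟨p, q, a, b, hq, hpa, hqb, rfl, rfl⟩ := h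
  refine ⟨q, p, b, a, ?_, hqb, hpa, inv_div _ _, by abel⟩
  rintro rfl
  simp at hf

theorem IsHomogeneousOfDegree.add {f f' : RatField σ} {g : M}
    (h : IsHomogeneousOfDegree deg f g) (h' : IsHomogeneousOfDegree deg f' g) :
    IsHomogeneousOfDegree deg (f + f') g := by
  obtain ⟨p, q, a, b, hq, hpa, hqb, rfl, rfl⟩ := h
  obtain ⟨p', q', a', b', hq', hpa', hqb', rfl, hg⟩ := h'
  have hinj := IsFractionRing.injective (MvPolynomial σ ℤ) (RatField σ)
  refine ⟨p * q' + q * p', q * q', a + b', b + b', mul_ne_zero hq hq',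
    (hpa.mul hqb').add ?_, hqb.mul hqb', ?_, by abel⟩
  · have : b + a' = a + b' := by
      rw [sub_eq_sub_iff_add_eq_add] at hg
      rw [hg, add_comm]
    rw [← this]
    exact hqb.mul hpa'
  · rw [div_add_div _ _ ((map_ne_zero_iff _ hinj).mpr hq) ((map_ne_zero_iff _ hinj).mpr hq')]
    simp only [map_add, map_mul]

variable (deg)

/-- The homogeneous subtraction-free rational functions. -/
def homogeneousSubgroup : Subgroup (SFRat σ) where
  carrier := {f | ∃ g, IsHomogeneousOfDegree deg f.val g}
  one_mem' := ⟨0, isHomogeneousOfDegree_one deg⟩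
  mul_mem' := fun ⟨_, h⟩ ⟨_, h'⟩ => ⟨_, h.mul h'⟩
  inv_mem' := fun {f} ⟨_, h⟩ => ⟨_, h.inv f.val_ne_zero⟩

/-- The subtraction-free rational functions of degree zero. -/
def degreeZeroSubgroup : Subgroup (SFRat σ) where
  carrier := {f | IsHomogeneousOfDegree deg f.val 0}
  one_mem' := isHomogeneousOfDegree_one deg
  mul_mem' := fun {f f'} h h' => by
    have := IsHomogeneousOfDegree.mul h h'
    rwa [add_zero] at this
  inv_mem' := fun {f} h => by
    have := IsHomogeneousOfDegree.inv f.val_ne_zero h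
    rwa [neg_zero] at this

theorem degreeZeroSubgroup_le : degreeZeroSubgroup deg ≤ homogeneousSubgroup deg :=
  fun _ h => ⟨0, h⟩

variable {deg}

theorem oplusSum_mem_degreeZero : ∀ (d : ℕ) (f : Fin (d + 1) → SFRat σ),
    (∀ s, f s ∈ degreeZeroSubgroup deg) → oplusSum d f ∈ degreeZeroSubgroup deg
  | 0, _, h => h 0
  | d + 1, _, h =>
    IsHomogeneousOfDegree.add (oplusSum_mem_degreeZero d _ fun s => h s.castSucc) (h (Fin.last _))

theorem exchangeEval_mem_degreeZero {d : ℕ} {z : Fin (d + 1) → SFRat σ} {u : SFRat σ}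
    (hz : ∀ s, z s ∈ degreeZeroSubgroup deg) (hu : u ∈ degreeZeroSubgroup deg) :
    exchangeEval d z u ∈ degreeZeroSubgroup deg :=
  oplusSum_mem_degreeZero _ _ fun s => mul_mem (hz s) (pow_mem hu _)

/-- A homogeneous function is determined by its restriction to a slice transversal to the
torus action defined by the grading. -/
theorem IsHomogeneousOfDegree.eq_mul_specialize {f : SFRat σ} {g : M}
    (h : IsHomogeneousOfDegree deg f.val g) (χ : Multiplicative M →* SFRat σ) :
    f = χ (Multiplicative.ofAdd g) *
      f.specialize fun a => SFRat.X a / χ (Multiplicative.ofAdd (deg a)) := by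
  set w : σ → SFRat σ := fun a => SFRat.X a / χ (Multiplicative.ofAdd (deg a)) with hw
  -- The homogeneous numerator and denominator may have negative coefficients, so they are evaluated
  -- at `w` in the field and compared afterwards with a subtraction-free representation.
  set ψ : MvPolynomial σ ℤ →+* RatField σ :=
    MvPolynomial.eval₂Hom (Int.castRingHom _) fun a => SFRat.valHom σ (w a) with hψ
  have hX : algebraMap (MvPolynomial σ ℤ) (RatField σ) =
      MvPolynomial.eval₂Hom (Int.castRingHom _) fun a => SFRat.valHom σ (SFRat.X a) := by
    apply MvPolynomial.ringHom_ext
    · intro r; simp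
    · intro i
      rw [MvPolynomial.coe_eval₂Hom, MvPolynomial.eval₂_X]
      change _ = natToRat σ (MvPolynomial.X i)
      simp [natToRat]
  -- Replacing each variable by its quotient by `χ` of its degree divides a monomial of degree `a`
  -- by `χ a`.
  have hhom : ∀ (p : MvPolynomial σ ℤ) (a : M), p.IsWeightedHomogeneous deg a →
      SFRat.valHom σ (χ (Multiplicative.ofAdd a)) * ψ p = algebraMap _ _ p := by
    intro p a hp
    rw [hX, hψ, MvPolynomial.coe_eval₂Hom, MvPolynomial.coe_eval₂Hom, MvPolynomial.eval₂_eq,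
      MvPolynomial.eval₂_eq, Finset.mul_sum]
    refine Finset.sum_congr rfl fun m hm => ?_
    have hma : Finsupp.weight deg m = a := hp (MvPolynomial.mem_support_iff.mp hm)
    rw [mul_left_comm]
    congr 1
    simp only [← map_pow, ← map_prod, ← map_mul]
    congr 1
    simp only [hw, div_pow, Finset.prod_div_distrib]
    have : χ (Multiplicative.ofAdd a) =
        ∏ i ∈ m.support, χ (Multiplicative.ofAdd (deg i)) ^ m i := by
      rw [← hma, Finsupp.weight_apply, Finsupp.sum, ofAdd_sum, map_prod]
      simp only [ofAdd_nsmul, map_pow]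
    rw [this, mul_div_cancel]
  have hnat : ∀ (p : MvPolynomial σ ℕ) (hp : p ≠ 0),
      ψ (MvPolynomial.map (Nat.castRingHom ℤ) p) = SFRat.valHom σ (posEval w p hp) := by
    intro p hp
    rw [map_posEval_eq_natEval (SFRat.valHom σ) (fun _ _ => rfl), hψ, MvPolynomial.coe_eval₂Hom,
      MvPolynomial.eval₂_map, natEval, MvPolynomial.coe_eval₂Hom]
    congr 1
  obtain ⟨p, q, a, b, hq, hpa, hqb, hf, rfl⟩ := h
  obtain ⟨p', q', hp', hq', hf'⟩ := f.exists_rep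
  have hinj := IsFractionRing.injective (MvPolynomial σ ℤ) (RatField σ)
  have hq0 : algebraMap _ (RatField σ) q ≠ 0 := (map_ne_zero_iff _ hinj).mpr hq
  have hcross : p * MvPolynomial.map (Nat.castRingHom ℤ) q'
      = MvPolynomial.map (Nat.castRingHom ℤ) p' * q := by
    apply hinj
    rw [map_mul, map_mul]
    have h := hf.symm.trans hf'
    rwa [div_eq_div_iff hq0 (natToRat_ne_zero hq')] at h
  have hψc := congrArg ψ hcross
  rw [map_mul, map_mul, hnat q' hq', hnat p' hp'] at hψc
  rw [SFRat.specialize_eq w f p' q' hp' hq' hf']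
  apply SFRat.ext
  have hpp := hhom p a hpa
  have hqq := hhom q b hqb
  have hne : ∀ e : SFRat σ, SFRat.valHom σ e ≠ 0 := SFRat.val_ne_zero
  have hv : ∀ a b : SFRat σ, SFRat.valHom σ (a / b) = SFRat.valHom σ a / SFRat.valHom σ b := by
    intro a b
    rw [div_eq_mul_inv, div_eq_mul_inv]
    rfl
  -- By `hqq` the value `ψ q` differs from the nonzero `q` only by a factor `χ b`.
  have hψq : ψ q ≠ 0 := fun h0 => hq0 (by rw [← hqq, h0, mul_zero])
  have h1 : ψ p / ψ q = SFRat.valHom σ (posEval w p' hp') / SFRat.valHom σ (posEval w q' hq') := by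
    rw [div_eq_div_iff hψq (hne _), hψc]
  refine hf.trans (Eq.trans ?_ (map_mul (SFRat.valHom σ) _ _).symm)
  rw [ofAdd_sub, map_div, hv, hv, ← h1, div_mul_div_comm, hpp, hqq]

end Homogeneous

/-! ## Generalized patterns with formal tropical coefficients -/

/-- The initial generalized seed with formal coefficients over `Trop(y, z)` and a given cluster. -/
noncomputable def tropSeed {n : ℕ} (d : Fin n → ℕ) (B : Matrix (Fin n) (Fin n) ℤ) {K : Type*}
    (x : Fin n → K) : GenSeed n d (Trop (Fin n ⊕ ZIndex d)) K where
  x := x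
  y := fun j => Trop.X (Sum.inl j)
  B := B
  z := formalZ fun p => Trop.X (Sum.inr p)

/-- The binomial coefficients as values of the formal variables `z_{i,s}`. -/
noncomputable def binZ {n : ℕ} (d : Fin n → ℕ) (P : Type*) [ClusterSemifield P] (p : ZIndex d) :
    P := posNat P ((d p.1.1).choose p.1.2) (choose_ne_zero p)

theorem Trop.toMonomial_X {σ G : Type*} [CommGroup G] (v : σ → G) (i : σ) :
    Trop.toMonomial v (Trop.X i) = v i := by
  change (Finsupp.single i (1 : ℤ)).prod _ = _
  rw [Finsupp.prod_single_index (zpow_zero _), zpow_one]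

theorem Trop.toMonomial_comp {σ G H : Type*} [CommGroup G] [CommGroup H] (f : G →* H)
    (v : σ → G) (m : Trop σ) :
    f (Trop.toMonomial v m) = Trop.toMonomial (fun i => f (v i)) m := by
  change f (Finsupp.prod _ _) = Finsupp.prod _ _
  simp only [Finsupp.prod, map_prod, map_zpow]

theorem Trop.toMonomial_eq_prod {n : ℕ} {τ G : Type*} [CommGroup G] (v : Fin n ⊕ τ → G)
    (m : Trop (Fin n ⊕ τ)) (hm : ∀ p, m.exponents (Sum.inr p) = 0) :
    Trop.toMonomial v m = ∏ i, v (Sum.inl i) ^ m.exponents (Sum.inl i) := by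
  change Finsupp.prod _ _ = _
  rw [Finsupp.prod_of_support_subset (s := Finset.univ.map Function.Embedding.inl)]
  · rw [Finset.prod_map]; rfl
  · intro a ha
    rcases a with i | p
    · simp
    · exact absurd (hm p) (Finsupp.mem_support_iff.mp ha)
  · intro i _; exact zpow_zero _

theorem Trop.exponents_one {σ : Type*} (a : σ) : (1 : Trop σ).exponents a = 0 := rfl

theorem Trop.exponents_inv {σ : Type*} (m : Trop σ) (a : σ) :
    (m⁻¹).exponents a = -m.exponents a := rfl

theorem Trop.exponents_zpow {σ : Type*} (m : Trop σ) (e : ℤ) (a : σ) :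
    (m ^ e).exponents a = e * m.exponents a := by
  change (e • (m.exponents : σ →₀ ℤ)) a = _
  simp

theorem Trop.exponents_pow {σ : Type*} (m : Trop σ) (e : ℕ) (a : σ) :
    (m ^ e).exponents a = e * m.exponents a := by
  rw [← zpow_natCast, exponents_zpow]

/-- The exponent of the sum is the minimum of nonnegative exponents, one of which is zero. -/
theorem Trop.exponents_oplusSum_eq_zero {σ : Type*} (a : σ) : ∀ (d : ℕ) (f : Fin (d + 1) → Trop σ),
    (f 0).exponents a = 0 → (∀ s, 0 ≤ (f s).exponents a) → (oplusSum d f).exponents a = 0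
  | 0, _, h0, _ => h0
  | d + 1, f, h0, h => by
    rw [oplusSum, exponents_add, Finsupp.inf_apply,
      exponents_oplusSum_eq_zero a d _ h0 fun s => h s.castSucc]
    exact min_eq_left (h _)

namespace GenSeed

variable {n : ℕ} {d : Fin n → ℕ} {K : Type*}

/-- The coefficients of a seed over `Trop(y, z)` do not involve `z`, and the coefficients of the
exchange polynomials are polynomial in `z`, the outer ones not involving `z`. -/
structure IsZFree (S : GenSeed n d (Trop (Fin n ⊕ ZIndex d)) K) : Prop where
  y_eq : ∀ j p, (S.y j).exponents (Sum.inr p) = 0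
  z_zero : ∀ k p, (S.z k 0).exponents (Sum.inr p) = 0
  z_last : ∀ k p, (S.z k (Fin.last (d k))).exponents (Sum.inr p) = 0
  z_nonneg : ∀ k s p, 0 ≤ (S.z k s).exponents (Sum.inr p)

/-- The constant term of the exchange polynomial involves no $z$ and the other terms involve only
nonnegative powers of $z$, so the tropical sum involves none. -/
theorem IsZFree.exchangeEval {S : GenSeed n d (Trop (Fin n ⊕ ZIndex d)) K} (h : S.IsZFree)
    (k : Fin n) (p : ZIndex d) :
    (exchangeEval (d k) (S.z k) (S.y k)).exponents (Sum.inr p) = 0 := by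
  apply Trop.exponents_oplusSum_eq_zero
  · rw [Trop.exponents_mul, Finsupp.add_apply, Trop.exponents_pow, h.y_eq, h.z_zero]
    simp
  · intro s
    rw [Trop.exponents_mul, Finsupp.add_apply, Trop.exponents_pow, h.y_eq, mul_zero, add_zero]
    exact h.z_nonneg k s p

variable [DivisionCommMonoid K] [Add K]

theorem IsZFree.mutate {S : GenSeed n d (Trop (Fin n ⊕ ZIndex d)) K} (h : S.IsZFree)
    (ι : Trop (Fin n ⊕ ZIndex d) →* K) (k : Fin n) : (S.mutate ι k).IsZFree where
  y_eq j p := by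
    simp only [GenSeed.mutate]
    split_ifs
    · rw [Trop.exponents_inv, h.y_eq, neg_zero]
    · rw [Trop.exponents_mul, Trop.exponents_mul, Finsupp.add_apply, Finsupp.add_apply,
        Trop.exponents_zpow, Trop.exponents_zpow, Trop.exponents_pow, h.y_eq, h.y_eq,
        h.exchangeEval]
      simp
  z_zero i p := by
    simp only [GenSeed.mutate]
    by_cases hi : i = k
    · subst hi
      rw [Function.update_self, Fin.rev_zero]
      exact h.z_last i p
    · rw [Function.update_of_ne hi]; exact h.z_zero i p
  z_last i p := by
    simp only [GenSeed.mutate]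
    by_cases hi : i = k
    · subst hi
      rw [Function.update_self, Fin.rev_last]
      exact h.z_zero i p
    · rw [Function.update_of_ne hi]; exact h.z_last i p
  z_nonneg i s p := by
    simp only [GenSeed.mutate]
    by_cases hi : i = k
    · subst hi
      rw [Function.update_self]
      exact h.z_nonneg i _ p
    · rw [Function.update_of_ne hi]; exact h.z_nonneg i s p

theorem isZFree_atVertex (B : Matrix (Fin n) (Fin n) ℤ) (x : Fin n → K)
    (ι : Trop (Fin n ⊕ ZIndex d) →* K) (t : List (Fin n)) :
    ((tropSeed d B x).atVertex ι t).IsZFree := by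
  induction t using List.reverseRecOn with
  | nil =>
    refine ⟨fun j p => ?_, fun k p => ?_, fun k p => ?_, fun k s p => ?_⟩
    · simp [atVertex, tropSeed, Trop.X, Trop.monomial, Trop.exponents]
    · simp [atVertex, tropSeed, formalZ, Trop.exponents_one]
    · simp [atVertex, tropSeed, formalZ, Trop.exponents_one]
    · simp only [atVertex, tropSeed, formalZ, List.foldl_nil]
      split_ifs with h
      · classical
        change 0 ≤ (Finsupp.single _ (1 : ℤ)) _
        rw [Finsupp.single_apply]
        split_ifs <;> simp
      · exact le_rfl
  | append_singleton t k ih =>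
    rw [atVertex_concat]
    exact ih.mutate ι k

/-- Binomial values of the exchange coefficients are preserved along a pattern. -/
theorem toMonomial_z_atVertex {G : Type*} [ClusterSemifield G] (B : Matrix (Fin n) (Fin n) ℤ)
    (x : Fin n → K) (ι : Trop (Fin n ⊕ ZIndex d) →* K) (y : Fin n → G) (t : List (Fin n))
    (i : Fin n) : ∀ s : Fin (d i + 1),
    Trop.toMonomial (Sum.elim y (binZ d G)) (((tropSeed d B x).atVertex ι t).z i s)
      = posNat G ((d i).choose s) (Nat.choose_pos s.is_le).ne' := by
  induction t using List.reverseRecOn with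
  | nil =>
    intro s
    have hone : ∀ m (hm : m ≠ 0), m = 1 → (1 : G) = posNat G m hm := by
      rintro _ _ rfl; exact (posNat_one G).symm
    simp only [atVertex, tropSeed, formalZ, List.foldl_nil]
    split_ifs with h
    · rw [Trop.toMonomial_X]; rfl
    · rw [map_one]
      apply hone
      -- Outside $0<s<d_i$ the formal coefficient is 1, which is the binomial coefficient at both
      -- ends.
      have : (s : ℕ) = 0 ∨ (s : ℕ) = d i := by have := s.is_le; omega
      rcases this with h | h <;> simp [h]
  | append_singleton t k ih =>
    intro s
    rw [atVertex_concat]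
    simp only [mutate]
    by_cases hi : i = k
    · subst hi
      rw [Function.update_self]
      rw [ih s.rev]
      congr 1
      -- Mutation reverses the exchange polynomial; the binomial coefficients are symmetric.
      rw [Fin.val_rev, Nat.add_sub_add_right, Nat.choose_symm s.is_le]
    · rw [Function.update_of_ne hi, ih]

end GenSeed
/-! ## Homogeneity of the `X`-functions -/

theorem isHomogeneousOfDegree_prod_zpow {σ M κ : Type*} [AddCommGroup M] {deg : σ → M}
    (s : Finset κ) (f : κ → SFRat σ) (g : κ → M)
    (h : ∀ i, IsHomogeneousOfDegree deg (f i).val (g i)) (b : κ → ℤ) :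
    IsHomogeneousOfDegree deg (∏ i ∈ s, f i ^ b i).val (∑ i ∈ s, b i • g i) := by
  -- Pairs of a function and one of its degrees form a subgroup, so products of integer powers need
  -- no separate induction.
  let H : Subgroup (SFRat σ × Multiplicative M) :=
    { carrier := {a | IsHomogeneousOfDegree deg a.1.val a.2.toAdd}
      one_mem' := isHomogeneousOfDegree_one deg
      mul_mem' := fun h h' => IsHomogeneousOfDegree.mul h h'
      inv_mem' := fun {a} h => IsHomogeneousOfDegree.inv a.1.val_ne_zero h }
  have : ∏ i ∈ s, ((f i, Multiplicative.ofAdd (g i)) : SFRat σ × Multiplicative M) ^ b i ∈ H :=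
    Subgroup.prod_mem _ fun i _ => Subgroup.zpow_mem _ (h i) _
  have h2 : IsHomogeneousOfDegree deg
    (∏ i ∈ s, ((f i, Multiplicative.ofAdd (g i)) : SFRat σ × Multiplicative M) ^ b i).1.val
    (∏ i ∈ s, ((f i, Multiplicative.ofAdd (g i)) : SFRat σ × Multiplicative M) ^ b i).2.toAdd :=
    this
  rw [Prod.fst_prod, Prod.snd_prod, toAdd_prod] at h2
  exact h2

section

variable {n : ℕ} {d : Fin n → ℕ}

/-- The inclusion of the formal coefficients in the universal semifield. -/
noncomputable def formalEmb (d : Fin n → ℕ) :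
    Trop (Fin n ⊕ ZIndex d) →* SFRat (Fin n ⊕ (Fin n ⊕ ZIndex d)) :=
  Trop.toMonomial fun a => SFRat.X (Sum.inr a)

theorem formalEmb_mem (deg : Fin n ⊕ (Fin n ⊕ ZIndex d) → Fin n → ℤ)
    (m : Trop (Fin n ⊕ ZIndex d)) : formalEmb d m ∈ homogeneousSubgroup deg :=
  Subgroup.prod_mem _ fun _ _ => Subgroup.zpow_mem _
    (show SFRat.X _ ∈ homogeneousSubgroup deg from ⟨_, isHomogeneousOfDegree_X deg _⟩) _

/-- Homogeneity survives a mutation because the exchange polynomial is evaluated at $\hat y_k$, of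
degree zero. The grading is chosen so that the initial $\hat y_j$ have degree zero, and
`yhat_mutate` propagates this. -/
theorem atVertex_homogeneous (B : Matrix (Fin n) (Fin n) ℤ) (hB : IsSkewSymmetrizable B)
    (t : List (Fin n)) :
    let S := (formalSeedX d B).atVertex (formalEmb d) t
    (∀ j, S.x j ∈ homogeneousSubgroup (varDegree d B)) ∧
      (∀ j, yhat (formalEmb d) S.x S.y S.B j ∈ degreeZeroSubgroup (varDegree d B)) ∧
      ∀ k s, formalEmb d (S.z k s) ∈ degreeZeroSubgroup (varDegree d B) := by
  induction t using List.reverseRecOn with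
  | nil =>
    refine ⟨fun j => ⟨_, isHomogeneousOfDegree_X _ _⟩, fun j => ?_, fun k s => ?_⟩
    · have h1 := isHomogeneousOfDegree_X (varDegree d B) (Sum.inr (Sum.inl j))
      have h2 := isHomogeneousOfDegree_prod_zpow Finset.univ
        (fun i : Fin n => SFRat.X (Sum.inl i)) _
        (fun i => isHomogeneousOfDegree_X (varDegree d B) (Sum.inl i)) (fun i => B i j)
      have h3 := h1.mul h2
      have hdeg : varDegree d B (Sum.inr (Sum.inl j)) +
          ∑ i, B i j • varDegree d B (Sum.inl i) = 0 := by
        funext l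
        simp [varDegree, Finset.sum_apply, Pi.single_apply]
      rw [hdeg] at h3
      change IsHomogeneousOfDegree _ (SFRat.val (formalEmb d (Trop.X (Sum.inl j)) * _)) 0
      rw [formalEmb, Trop.toMonomial_X]
      exact h3
    · simp only [GenSeed.atVertex, formalSeedX, formalZ, List.foldl_nil]
      split_ifs with h
      · rw [formalEmb, Trop.toMonomial_X]
        exact isHomogeneousOfDegree_X (varDegree d B) (Sum.inr (Sum.inr _))
      · rw [map_one]; exact one_mem _
  | append_singleton t k ih =>
    intro S
    obtain ⟨hx, hy, hz⟩ := ih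
    have hS : S = ((formalSeedX d B).atVertex (formalEmb d) t).mutate (formalEmb d) k :=
      GenSeed.atVertex_concat _ _ _ _
    set T := (formalSeedX d B).atVertex (formalEmb d) t with hT
    rw [hS]
    refine ⟨fun j => ?_, fun j => ?_, fun i => ?_⟩
    · simp only [GenSeed.mutate]
      by_cases hj : j = k
      · subst hj
        rw [Function.update_self]
        exact mul_mem (mul_mem (inv_mem (hx j)) (pow_mem (Subgroup.prod_mem _ fun i _ =>
            Subgroup.zpow_mem _ (hx i) _) _))
          (div_mem (degreeZeroSubgroup_le _ (exchangeEval_mem_degreeZero (hz j) (hy j)))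
            (formalEmb_mem _ _))
      · rw [Function.update_of_ne hj]; exact hx j
    · rw [GenSeed.yhat_mutate (formalEmb d) T k
        ((GenSeed.isSkewSymmetrizable_atVertex (formalEmb d) (formalSeedX d B) hB t).diag k)]
      split_ifs
      · exact inv_mem (hy k)
      · exact mul_mem (mul_mem (hy j) (Subgroup.zpow_mem _ (pow_mem (hy k) _) _))
          (Subgroup.zpow_mem _ (exchangeEval_mem_degreeZero (hz k) (hy k)) _)
    · simp only [GenSeed.mutate]
      by_cases hi : i = k
      · subst hi
        rw [Function.update_self]
        exact fun s => hz i _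
      · rw [Function.update_of_ne hi]; exact hz i

/-- The default value in `gVector` is never taken. Any degree that the choice returns suffices for
what follows; its uniqueness is not needed. -/
theorem isHomogeneous_gVector (B : Matrix (Fin n) (Fin n) ℤ) (hB : IsSkewSymmetrizable B)
    (t : List (Fin n)) (j : Fin n) :
    IsHomogeneousOfDegree (varDegree d B) (XFun d B t j).val (gVector d B t j) := by
  have h : ∃ g, IsHomogeneousOfDegree (varDegree d B) (XFun d B t j).val g :=
    (atVertex_homogeneous B hB t).1 j
  rw [gVector, dif_pos h]
  exact h.choose_spec

/-! ### Separation formulas: $X$-functions, $c$-vectors and $F$-polynomials as evaluations of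
patterns -/

/-- The separation of the `g`-vector from the `F`-polynomial. -/
theorem XFun_specialize {Q : Type*} [ClusterSemifield Q] (B : Matrix (Fin n) (Fin n) ℤ)
    (hB : IsSkewSymmetrizable B) (t : List (Fin n)) (j : Fin n) (x y : Fin n → Q)
    (z : ZIndex d → Q) :
    (XFun d B t j).specialize (Sum.elim x (Sum.elim y z)) =
      (∏ i, x i ^ gVector d B t j i) *
        (FPoly d B t j).specialize (Sum.elim (yhat (MonoidHom.id Q) x y B) z) := by
  -- The character sends $\mathbf e_i$ to $x_i$. Dividing each variable by the character of its
  -- degree turns $x_i$ into 1 and $y_j$ into $\hat y_j$, and fixes $z_{i,s}$.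
  let χ : Multiplicative (Fin n → ℤ) →* SFRat (Fin n ⊕ (Fin n ⊕ ZIndex d)) :=
    MonoidHom.mk' (fun m => ∏ i, SFRat.X (Sum.inl i) ^ m.toAdd i) fun a b => by
      simp only [toAdd_mul, Pi.add_apply, zpow_add, Finset.prod_mul_distrib]
  have hχ : ∀ m, χ m = ∏ i, SFRat.X (Sum.inl i) ^ m.toAdd i := fun _ => rfl
  have h := congrArg (SFRat.specializeHom (Sum.elim x (Sum.elim y z)))
    ((isHomogeneous_gVector B hB t j).eq_mul_specialize χ)
  rw [SFRat.specializeHom_apply] at h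
  rw [h, map_mul, SFRat.specializeHom_apply (f := SFRat.specialize _ _),
    SFRat.specialize_specialize, FPoly, SFRat.specialize_specialize, hχ, map_prod]
  simp only [map_zpow, SFRat.specializeHom_apply, SFRat.specialize_X, Sum.elim_inl, toAdd_ofAdd]
  congr 2
  funext a
  rw [← SFRat.specializeHom_apply, map_div, hχ, map_prod]
  simp only [map_zpow, SFRat.specializeHom_apply, SFRat.specialize_X, Sum.elim_inl, toAdd_ofAdd]
  rcases a with i | j | p
  · have h1 : ∏ l, x l ^ (Pi.single i (1 : ℤ) : Fin n → ℤ) l = x i := by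
      rw [Finset.prod_eq_single i]
      · simp
      · intro l _ hl; simp [hl]
      · simp
    have h2 : ((1 : SFRat (Fin n ⊕ ZIndex d))).specialize
        (Sum.elim (yhat (MonoidHom.id Q) x y B) z) = 1 := map_one (SFRat.specializeHom _)
    simp [varDegree, h1, h2]
  · simp [varDegree, yhat]
  · simp [varDegree]

/-- `X`-functions evaluated in a semifield. -/
theorem tropSeed_atVertex_x {Q : Type*} [ClusterSemifield Q] (B : Matrix (Fin n) (Fin n) ℤ)
    (t : List (Fin n)) (j : Fin n) (x : Fin n → Q) (v : Fin n ⊕ ZIndex d → Q) :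
    ((tropSeed d B x).atVertex (Trop.toMonomial v) t).x j =
      (XFun d B t j).specialize (Sum.elim x v) := by
  -- Coefficients stay in the tropical semifield, since `Trop.toMonomial v` need not respect
  -- $\oplus$; only the cluster is specialized.
  have h := GenSeed.map_atVertex (formalEmb d) (Trop.toMonomial v)
    (MonoidHom.id (Trop (Fin n ⊕ ZIndex d))) (SFRat.specializeHom (Sum.elim x v))
    (fun _ _ => rfl) (SFRat.specializeHom_add _)
    (fun p => by
      rw [formalEmb, Trop.toMonomial_comp]
      simp) (formalSeedX d B) t
  have h0 : (formalSeedX d B).map (MonoidHom.id (Trop (Fin n ⊕ ZIndex d)))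
      (SFRat.specializeHom (Sum.elim x v)) = tropSeed d B x := by
    simp [GenSeed.map, formalSeedX, tropSeed]
  rw [h0] at h
  rw [← h]
  rfl

/-- The `c`-vectors are the exponents of the coefficients in the formal tropical pattern. -/
theorem cEntry_eq {K : Type*} [ClusterSemifield K] (B : Matrix (Fin n) (Fin n) ℤ)
    (t : List (Fin n)) (i j : Fin n) (x : Fin n → K) (ι : Trop (Fin n ⊕ ZIndex d) →* K) :
    cEntry d B t i j = (((tropSeed d B x).atVertex ι t).y j).exponents (Sum.inl i) := by
  have h := GenSeed.map_atVertex (MonoidHom.id _) (MonoidHom.id _)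
    (SFRat.specializeHom (Trop.X (σ := Fin n ⊕ ZIndex d)))
    (SFRat.specializeHom (Trop.X (σ := Fin n ⊕ ZIndex d)))
    (SFRat.specializeHom_add _) (SFRat.specializeHom_add _) (fun _ => rfl) (formalSeedY d B) t
  have hz : (tropSeed d B x).z = ((formalSeedY d B).map
      (SFRat.specializeHom (Trop.X (σ := Fin n ⊕ ZIndex d)))
      (SFRat.specializeHom (Trop.X (σ := Fin n ⊕ ZIndex d)))).z := by
    funext k s
    simp only [tropSeed, formalZ, GenSeed.map, formalSeedY]
    split_ifs
    · simp
    · rw [map_one]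
  have h2 := (GenSeed.atVertex_congr ι (MonoidHom.id _) (tropSeed d B x)
    ((formalSeedY d B).map _ _) rfl (by simp [tropSeed, GenSeed.map, formalSeedY]) hz t).2.1
  rw [h2, ← h]
  rfl

theorem FBin_specialize {Q : Type*} [ClusterSemifield Q] (B : Matrix (Fin n) (Fin n) ℤ)
    (t : List (Fin n)) (j : Fin n) (y : Fin n → Q) :
    (FBin d B t j).specialize y = (FPoly d B t j).specialize (Sum.elim y (binZ d Q)) := by
  rw [FBin, SFRat.specialize_specialize]
  congr 1
  funext a
  rcases a with i | p
  · simp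
  · exact SFRat.specialize_const _ _ (choose_ne_zero p)

/-- This makes the values of $F$-polynomials the cluster of a pattern, so that their recursion is
mutation itself. -/
theorem FPoly_specialize {Q : Type*} [ClusterSemifield Q] (B : Matrix (Fin n) (Fin n) ℤ)
    (t : List (Fin n)) (j : Fin n) (v : Fin n ⊕ ZIndex d → Q) :
    (FPoly d B t j).specialize v =
      ((tropSeed d B fun _ => (1 : Q)).atVertex (Trop.toMonomial v) t).x j := by
  rw [FPoly, SFRat.specialize_specialize, tropSeed_atVertex_x]
  congr 1
  funext a
  rcases a with i | p
  · exact map_one (SFRat.specializeHom v)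
  · simp

end

/-! ## The left companion pattern -/

theorem Seed.atVertex_concat {n : ℕ} {P K : Type*} [ClusterSemifield P] [DivisionCommMonoid K]
    [Add K] (ι : P →* K) (S : Seed n P K) (t : List (Fin n)) (k : Fin n) :
    S.atVertex ι (t ++ [k]) = (S.atVertex ι t).mutate ι k := by
  simp [Seed.atVertex, List.foldl_append]

theorem mul_pos_part (a : ℕ) (b : ℤ) : pos (a * b) = a * pos b := by
  rw [pos, pos, mul_max_of_nonneg _ _ (Int.natCast_nonneg a), mul_zero]

theorem map_zpow_group {G L : Type*} [Group G] [DivisionRing L] (g : G →* L) (a : G) (m : ℤ) :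
    g (a ^ m) = g a ^ m :=
  map_zpow' g (fun x => by
    refine eq_inv_of_mul_eq_one_left ?_
    rw [← map_mul, inv_mul_cancel, map_one]) a m

variable {n : ℕ} {d : Fin n → ℕ}

/-- `T` is the left companion; `F` and `X` share matrices and formal tropical coefficients and
differ only in their initial clusters and in where the monomials are realized. The three conclusions
are proved together, as the mutation of each uses the others. -/
theorem leftCompanion_atVertex {P Q L : Type*} [ClusterSemifield P] [ClusterSemifield Q] [Field L]
    (ι : P →* Q) (g : Q →* L) (hg : ∀ a b, g (a + b) = g a + g b) (κ : P →* L)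
    (hκ : ∀ p, g (ι p) = κ p) (B : Matrix (Fin n) (Fin n) ℤ) (hB : IsSkewSymmetrizable B)
    (x : Fin n → Q) (y : Fin n → P) (u : Fin n → L) (hu : ∀ i, u i ^ d i = g (x i))
    (t : List (Fin n)) :
    let T := Seed.atVertex κ ⟨u, y, Matrix.diagonal (fun i => (d i : ℤ)) * B⟩ t
    let F := (tropSeed d B fun _ => (1 : P)).atVertex
      (Trop.toMonomial (Sum.elim y (binZ d P))) t
    let X := (tropSeed d B x).atVertex
      (Trop.toMonomial (Sum.elim (fun i => ι (y i)) (binZ d Q))) t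
    (∀ i j, T.B i j = d i * F.B i j) ∧
      (∀ j, T.y j = yhat (Trop.toMonomial (Sum.elim y (binZ d P))) F.x F.y F.B j) ∧
      ∀ i, T.x i ^ d i = g (X.x i / ι (F.x i)) := by
  set ιP := Trop.toMonomial (Sum.elim y (binZ d P)) with hιP
  set ιQ := Trop.toMonomial (Sum.elim (fun i => ι (y i)) (binZ d Q)) with hιQ
  -- The inclusion `ι` is not assumed additive, so it need not match the integer constants of `P`
  -- and `Q`. The two realizations are compared only on monomials free of $z$.
  have hcompat : ∀ m : Trop (Fin n ⊕ ZIndex d), (∀ p, m.exponents (Sum.inr p) = 0) →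
      ι (ιP m) = ιQ m := by
    intro m hm
    rw [hιP, hιQ, Trop.toMonomial_eq_prod _ _ hm, Trop.toMonomial_eq_prod _ _ hm, map_prod]
    simp only [map_zpow, Sum.elim_inl]
  induction t using List.reverseRecOn with
  | nil =>
    refine ⟨fun i j => ?_, fun j => ?_, fun i => ?_⟩
    · exact Matrix.diagonal_mul _ _ _ _
    · change y j = ιP (Trop.X (Sum.inl j)) * ∏ i, (1 : P) ^ B i j
      rw [hιP, Trop.toMonomial_X]
      simp
    · change u i ^ d i = g (x i / ι 1)
      rw [hu, map_one, div_one]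
  | append_singleton t k ih =>
    rw [Seed.atVertex_concat, GenSeed.atVertex_concat, GenSeed.atVertex_concat]
    obtain ⟨hXB, hXy, hXz⟩ := GenSeed.atVertex_congr ιQ ιP (tropSeed d B x)
      (tropSeed d B fun _ => (1 : P)) rfl rfl rfl t
    have hfree := GenSeed.isZFree_atVertex B (fun _ => (1 : P)) ιP t
    have hzP := GenSeed.toMonomial_z_atVertex (d := d) B (fun _ => (1 : P)) ιP y t k
    have hzQ := GenSeed.toMonomial_z_atVertex (d := d) B x ιQ (fun i => ι (y i)) t k
    have hdiag := (GenSeed.isSkewSymmetrizable_atVertex ιP (tropSeed d B fun _ => (1 : P)) hB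
      t).diag k
    rw [← hιP] at hzP
    rw [← hιQ] at hzQ
    set T := Seed.atVertex κ ⟨u, y, Matrix.diagonal (fun i => (d i : ℤ)) * B⟩ t
    set F := (tropSeed d B fun _ => (1 : P)).atVertex ιP t
    set X := (tropSeed d B x).atVertex ιQ t
    obtain ⟨hTB, hTy, hTx⟩ := ih
    have hEP : ∀ w, exchangeEval (d k) (fun s => ιP (F.z k s)) w = (1 + w) ^ d k := by
      intro w
      simp only [hzP]
      exact exchangeEval_choose _ _
    have hEQ : ∀ w, exchangeEval (d k) (fun s => ιQ (X.z k s)) w = (1 + w) ^ d k := by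
      intro w
      simp only [hzQ]
      exact exchangeEval_choose _ _
    refine ⟨fun i j => ?_, fun j => ?_, fun i => ?_⟩
    · simp only [Seed.mutate, GenSeed.mutate, hTB]
      split_ifs
      · ring
      · rw [← mul_neg, mul_pos_part, mul_pos_part]
        ring
    · rw [GenSeed.yhat_mutate ιP F k hdiag]
      simp only [Seed.mutate, hEP, hTy, hTB, mul_pos_part]
      split_ifs
      · rfl
      -- The degree $d_k$ moves from the base into the exponent, where it turns $b_{kj}$ into the
      -- entry of the companion matrix.
      · rw [← zpow_natCast, ← zpow_natCast, ← zpow_mul, ← zpow_mul, mul_neg]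
    · simp only [Seed.mutate, GenSeed.mutate]
      by_cases hi : i = k
      · subst hi
        simp only [Function.update_self]
        -- The coefficient of `T` contributes $\prod_l F_l^{b_{li}}$ and the cluster contributes
        -- $\prod_l (X_l/F_l)^{b_{li}}$, the roots being absorbed by the factor $d_l$ in
        -- $d_lb_{li}$. The $F_l$ cancel and leave the $\hat y_i$ of `X`.
        have hyh : yhat κ T.x T.y T.B i = g (yhat ιQ X.x X.y X.B i) := by
          have h1 : ∀ l, T.x l ^ T.B l i = g ((X.x l / ι (F.x l)) ^ F.B l i) := by
            intro l
            rw [hTB, zpow_mul, zpow_natCast, hTx, map_zpow_group]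
          simp only [yhat, h1]
          rw [← map_prod g, ← hκ, ← map_mul g, hTy, yhat, map_mul ι, map_prod ι,
            hcompat _ (hfree.y_eq i), hXB, hXy, mul_assoc, ← Finset.prod_mul_distrib]
          congr 2
          refine Finset.prod_congr rfl fun l _ => ?_
          rw [map_zpow, ← mul_zpow, mul_div_cancel]
        have hM : (∏ l, T.x l ^ pos (-T.B l i)) ^ d i =
            g ((∏ l, (X.x l / ι (F.x l)) ^ pos (-F.B l i)) ^ d i) := by
          rw [map_pow, map_prod]
          congr 1
          refine Finset.prod_congr rfl fun l _ => ?_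
          rw [hTB, ← mul_neg, mul_pos_part, zpow_mul, zpow_natCast, hTx, map_zpow_group]
        have hinv : ∀ a : Q, (g a)⁻¹ = g a⁻¹ := fun a => by
          have := map_zpow_group g a (-1)
          rwa [zpow_neg_one, zpow_neg_one, eq_comm] at this
        have hdiv : ∀ a b : Q, g a / g b = g (a / b) := fun a b => by
          rw [div_eq_mul_inv, div_eq_mul_inv, hinv, map_mul]
        -- The $d_i$-th power of the ordinary exchange relation is rewritten as the image under `g`
        -- of an identity in `Q`. The tropical denominators of `X` and `F` agree there by `hcompat`,
        -- hence cancel in the quotient.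
        rw [mul_pow, mul_pow, hM, inv_pow, hTx, hinv, hyh, ← hκ, ← map_one g, ← hg, hdiv,
          ← map_pow, ← map_mul, ← map_mul, hEQ, hEP, ← hTy, hXB, hXy, hXz,
          ← hcompat _ (hfree.exchangeEval i)]
        congr 1
        simp only [map_mul, map_div, map_inv, map_pow, map_prod, map_zpow, div_zpow, div_pow,
          Finset.prod_div_distrib]
        rw [mul_div_mul_comm, mul_div_mul_comm, div_div_div_cancel_right]
        congr 2
        rw [div_inv_eq_mul, inv_div, div_eq_mul_inv, mul_comm]
      · simp only [Function.update_of_ne hi]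
        exact hTx i

end GenCluster

/-! ### Conclusion: the binomial specialization in terms of the patterns `F` and `X` -/

theorem mainTheorem1 {P : Type*} [GenCluster.ClusterSemifield P]
    {K : Type*} [Field K] [Algebra (GenCluster.QP P) K]
    {n : ℕ} {d : Fin n → ℕ} (S : GenCluster.GenSeed n d P K) (hS : S.IsSeed)
    {L : Type*} [Field L] [Algebra (GenCluster.QP P) L] [Algebra K L]
    [IsScalarTower (GenCluster.QP P) K L]
    (u : Fin n → L) (hu : ∀ i, u i ^ d i = algebraMap K L (S.x i))
    (t : List (Fin n)) :
    (∀ i, algebraMap K L (S.xBin t i) =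
      (((S.leftCompanion u).atVertex (GenCluster.coeffEmb P L) t).x i) ^ d i) ∧
    (∀ j, S.yBin t j = ((S.leftCompanion u).atVertex (GenCluster.coeffEmb P L) t).y j) := by
  open GenCluster in
  obtain ⟨Q, _, g, ι, x, hg, hgι, hgx⟩ := exists_semifield S.x hS.algebraicIndependent
  have hB := hS.skewSymmetrizable
  have hκ : ∀ p, ((algebraMap K L : K →* L).comp g) (ι p) = coeffEmb P L p := by
    intro p
    simp [hgι, coeffEmb, IsScalarTower.algebraMap_apply (QP P) K L]
  obtain ⟨-, hy, hx⟩ := leftCompanion_atVertex (d := d) ι ((algebraMap K L : K →* L).comp g)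
    (fun a b => by simp [hg]) (coeffEmb P L) hκ S.B hB x S.y u (fun i => by simp [hu, hgx]) t
  have hF : ∀ i, (FBin d S.B t i).specialize S.y =
      ((tropSeed d S.B fun _ => (1 : P)).atVertex
        (Trop.toMonomial (Sum.elim S.y (binZ d P))) t).x i := fun i => by
    rw [FBin_specialize, FPoly_specialize]
  constructor
  · intro i
    refine Eq.trans ?_ (hx i).symm
    -- The point $\hat{\mathbf y}$ has coordinates in the image of `Q`, so `SFRat.evalField_map`
    -- turns the evaluation in the field into a specialization in `Q`.
    have hyh : yhat (coeffEmb P K) S.x S.y S.B =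
        fun l => g (yhat (MonoidHom.id Q) x (fun i => ι (S.y i)) S.B l) := by
      funext l
      simp only [yhat, map_mul, map_prod, map_zpow_group, MonoidHom.id_apply, hgι, hgx]
    have hdiv : ∀ a b : Q, g (a / b) = g a / g b := fun a b => by
      rw [div_eq_mul_inv, map_mul, ← zpow_neg_one, map_zpow_group, zpow_neg_one, div_eq_mul_inv]
    rw [MonoidHom.comp_apply, tropSeed_atVertex_x, XFun_specialize S.B hB, ← FBin_specialize,
      hdiv, map_mul, map_prod, ← SFRat.evalField_map g hg, ← hyh, hgι, ← hF, GenSeed.xBin]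
    simp only [map_zpow_group, hgx, mul_div_assoc]
    rfl
  · intro j
    refine Eq.trans ?_ (hy j).symm
    -- As the tropical coefficient involves no $z$, its realization is the product of the $y_i$ to
    -- the $c$-vector exponents, without binomial constants.
    rw [GenSeed.yBin, yhat, Trop.toMonomial_eq_prod _ _
      ((GenSeed.isZFree_atVertex S.B _ _ t).y_eq j)]
    congr 1
    · refine Finset.prod_congr rfl fun i _ => ?_
      rw [cEntry_eq S.B t i j (fun _ => (1 : P)) (Trop.toMonomial (Sum.elim S.y (binZ d P))),
        Sum.elim_inl]
    · refine Finset.prod_congr rfl fun i _ => ?_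
      rw [hF, GenSeed.atVertex_B_congr (coeffEmb P K)
        (Trop.toMonomial (Sum.elim S.y (binZ d P))) S (tropSeed d S.B fun _ => (1 : P)) rfl]
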